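/- Let $\Omega\subset\mathbb C^n$ be a bounded domain and $1<p<\infty$. Let $$A^p(\Omega)=\Big\{f\in\mathcal O(\Omega):\ \|f\|_p^p:=\int_\Omega|f|^p<\infty\Big\}$$ (integration with respect to Lebesgue measure), and for $z\in\Omega$ put $$m_p(z)=\inf\{\|f\|_p:\ f\in A^p(\Omega),\ f(z)=1\},\qquad K_p(z)=m_p(z)^{-p}.$$ Then: (i) for every $z\in\Omega$ the infimum $m_p(z)$ is attained by exactly one $f\in A^p(\Omega)$ with $f(z)=1$; this minimizer is denoted by $m_p(\cdot,z)$, and one sets $K_p(w,z)=m_p(w,z)K_p(z)$ for $w\in\Omega$; (ii) the $p$-Bergman kernel $K_p(\cdot)$ belongs to $C^{1,1/2}(\Omega)$, that is, $K_p(\cdot)$ is continuously differentiable on $\Omega$ in the real sense and its derivative is Hölder continuous of exponent $1/2$ on every compact subset of $\Omega$; (iii) for every $1\le j\le 2n$ and every $z\in\Omega$, $$\frac{\partial K_p}{\partial x_j}(z)=p\,\mathrm{Re}\,\frac{\partial K_p(\cdot,z)}{\partial x_j}\bigg|_{z},$$ where $(x_1,\dots,x_{2n})$ are the real coordinates of $\mathbb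 R^{2n}=\mathbb C^n$. -/

import Mathlib

open MeasureTheory Set
open scoped NNReal

noncomputable section

namespace PBergman

/-- The function `f` belongs to the `p`-Bergman space `A^p(Ω)`: it is holomorphic on `Ω` and `|f|^p`
is Lebesgue integrable over `Ω`. Functions on `Ω` are represented by functions on the whole of `ℂⁿ`;
only the values on `Ω` matter. -/
def MemBergman {n : ℕ} (Ω : Set (EuclideanSpace ℂ (Fin n))) (p : ℝ)
    (f : EuclideanSpace ℂ (Fin n) → ℂ) : Prop :=
  DifferentiableOn ℂ f Ω ∧ IntegrableOn (fun w => ‖f w‖ ^ p) Ω volume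

/-- The norm `‖f‖_p = (∫_Ω |f|^p)^{1/p}`. -/
def bergmanNorm {n : ℕ} (Ω : Set (EuclideanSpace ℂ (Fin n))) (p : ℝ)
    (f : EuclideanSpace ℂ (Fin n) → ℂ) : ℝ :=
  (∫ w in Ω, ‖f w‖ ^ p) ^ (1 / p)

/-- The minimum `m_p(z) = inf {‖f‖_p : f ∈ A^p(Ω), f(z) = 1}`. -/
def minNorm {n : ℕ} (Ω : Set (EuclideanSpace ℂ (Fin n))) (p : ℝ)
    (z : EuclideanSpace ℂ (Fin n)) : ℝ :=
  sInf {r : ℝ | ∃ f : EuclideanSpace ℂ (Fin n) → ℂ,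
    MemBergman Ω p f ∧ f z = 1 ∧ r = bergmanNorm Ω p f}

/-- `f` is a minimizer of the problem defining `m_p(z)`. -/
def IsMinimizer {n : ℕ} (Ω : Set (EuclideanSpace ℂ (Fin n))) (p : ℝ)
    (z : EuclideanSpace ℂ (Fin n)) (f : EuclideanSpace ℂ (Fin n) → ℂ) : Prop :=
  MemBergman Ω p f ∧ f z = 1 ∧ bergmanNorm Ω p f = minNorm Ω p z

open Classical in
/-- The minimizer `m_p(·, z)`. Its values are `0` if no minimizer exists, and its values
outside `Ω` carry no meaning. -/
def minimizer {n : ℕ} (Ω : Set (EuclideanSpace ℂ (Fin n))) (p : ℝ)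
    (z : EuclideanSpace ℂ (Fin n)) : EuclideanSpace ℂ (Fin n) → ℂ :=
  if h : ∃ f : EuclideanSpace ℂ (Fin n) → ℂ, IsMinimizer Ω p z f then h.choose else 0

/-- The `p`-Bergman kernel `K_p(z) = m_p(z)^{-p}`. -/
def kernel {n : ℕ} (Ω : Set (EuclideanSpace ℂ (Fin n))) (p : ℝ)
    (z : EuclideanSpace ℂ (Fin n)) : ℝ :=
  minNorm Ω p z ^ (-p)

/-- The off-diagonal `p`-Bergman kernel `K_p(w, z) = m_p(w, z) K_p(z)`. -/
def offDiagKernel {n : ℕ} (Ω : Set (EuclideanSpace ℂ (Fin n))) (p : ℝ)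
    (w z : EuclideanSpace ℂ (Fin n)) : ℂ :=
  minimizer Ω p z w * (kernel Ω p z : ℂ)

/-- The standard basis of `ℝ²ⁿ = ℂⁿ`: `inl k` is the direction of `Re z_k`, and `inr k` is the
direction of `Im z_k`. -/
def realBasis {n : ℕ} : Fin n ⊕ Fin n → EuclideanSpace ℂ (Fin n) :=
  Sum.elim (fun k => EuclideanSpace.single k 1) (fun k => EuclideanSpace.single k Complex.I)

/-- The partial derivative `∂u/∂x_j (z)` with respect to a real coordinate of `ℝ²ⁿ = ℂⁿ`. -/
def realPartial {n : ℕ} {F : Type*} [NormedAddCommGroup F] [NormedSpace ℝ F]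
    (u : EuclideanSpace ℂ (Fin n) → F) (j : Fin n ⊕ Fin n)
    (z : EuclideanSpace ℂ (Fin n)) : F :=
  lineDeriv ℝ u z (realBasis j)

/-- The class `C^{1,r}(Ω)` on an open set `Ω`: continuously differentiable (in the real sense), with
derivative Hölder continuous of exponent `r` on every compact subset of `Ω`. -/
def IsC1Holder {n : ℕ} (r : ℝ≥0) (Ω : Set (EuclideanSpace ℂ (Fin n)))
    (u : EuclideanSpace ℂ (Fin n) → ℝ) : Prop :=
  ContDiffOn ℝ 1 u Ω ∧
    ∀ S : Set (EuclideanSpace ℂ (Fin n)), IsCompact S → S ⊆ Ω →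
      ∃ C : ℝ≥0, HolderOnWith C r (fderiv ℝ u) S

end PBergman

end

/-!
The argument rests on the midpoint convexity defect
`Δ(a, b) = (|a|^p + |b|^p) / 2 - |(a + b) / 2|^p` of `|·|^p` on `ℂ`. If `f` and `g` lie in `A^p(Ω)`,
then `K_p(z) = sup |h(z)|^p / ‖h‖_p^p`, tested on `h = (f + g) / 2`, bounds `∫_Ω Δ(f, g)` by the
amount by which `f` and `g` fail to be extremal at `z` (`integral_convexityDefect_le`). The defect
is strictly positive off the diagonal, with a power lower bound on bounded sets
(`exists_rpow_le_convexityDefect`), so the sub-mean value inequality turns a small defect integral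
into uniform closeness on compact sets. Applied to a minimizing sequence this gives the minimizer,
with Fatou's lemma for its norm; applied to two minimizers it gives uniqueness.

For the regularity, write `f_z = m_p(·, z)` and `A(z) = m_p(z)^p`, and compare `f_z` with `f_w` at
the point where `A` is larger. Since all minimizers are uniformly bounded, hence uniformly
Lipschitz, near a compact set, `∫_Ω Δ(f_z, f_w) = O(|z - w|)`. The function `f_z` has modulus at
least `1/2` near `z`, and away from the origin `Δ(a, b)` dominates `|a - b|²` whatever the value of
`p` (`exists_sq_le_convexityDefect`). Hence `|f_z - f_w|² = O(|z - w|)` near `z`, and by Cauchy's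
estimate `df_z(z)` is Hölder continuous of order `1/2` in `z`
(`exists_norm_fderiv_minimizer_sub_le`).

Finally `f_z` is a competitor at `w` and `f_w` one at `z`, that is,
`K_p(w) ≥ |f_z(w)|^p K_p(z)` and `K_p(z) ≥ |f_w(z)|^p K_p(w)`. Linearizing both traps
`K_p(w) - K_p(z)` between `D_z(w - z)` and `D_w(w - z)` up to `O(|w - z|²)`, where
`D_z = p K_p(z) Re df_z(z)`. The Hölder continuity of `D` then shows that `D_z` is the differential
of `K_p` at `z` (`exists_kernel_expansion`), which is the formula for the partial derivatives.
-/

noncomputable section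

namespace PBergman

open Metric Filter
open scoped Topology

/-! ### Cauchy estimates in several variables -/

section CauchyEstimates

variable {E : Type*} [NormedAddCommGroup E] [NormedSpace ℂ E] {f : E → ℂ} {z w : E} {r M : ℝ}

/-- Cauchy's estimate for the derivative in several variables, reduced to one variable on each
complex line through the centre. -/
theorem norm_fderiv_le_of_closedBall (hr : 0 < r)
    (hd : ∀ x ∈ closedBall z r, DifferentiableAt ℂ f x)
    (hb : ∀ x ∈ closedBall z r, ‖f x‖ ≤ M) : ‖fderiv ℂ f z‖ ≤ M / r := by
  have hM : 0 ≤ M := (norm_nonneg _).trans (hb z (mem_closedBall_self hr.le))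
  refine ContinuousLinearMap.opNorm_le_bound _ (by positivity) fun v ↦ ?_
  rcases eq_or_ne v 0 with rfl | hv
  · simp
  have hv' : 0 < ‖v‖ := norm_pos_iff.2 hv
  have hmem : ∀ t : ℂ, ‖t‖ ≤ r / ‖v‖ → z + t • v ∈ closedBall z r := fun t ht ↦ by
    rw [mem_closedBall_iff_norm, add_sub_cancel_left, norm_smul]
    exact (le_div_iff₀ hv').1 ht
  have hφ : ∀ t : ℂ, ‖t‖ ≤ r / ‖v‖ → DifferentiableAt ℂ (fun t : ℂ ↦ f (z + t • v)) t :=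
    fun t ht ↦ (hd _ (hmem t ht)).comp t (by fun_prop)
  have key := Complex.norm_deriv_le_of_forall_mem_sphere_norm_le (c := 0) (R := r / ‖v‖) (C := M)
    (f := fun t : ℂ ↦ f (z + t • v)) (by positivity)
    (DifferentiableOn.diffContOnCl fun t ht ↦ (hφ t (by
      simpa using closure_ball_subset_closedBall ht)).differentiableWithinAt)
    (fun t ht ↦ hb _ (hmem t (by simpa using ht.le)))
  have hder : deriv (fun t : ℂ ↦ f (z + t • v)) 0 = fderiv ℂ f z v := by
    simpa [lineDeriv] using (hd z (mem_closedBall_self hr.le)).lineDeriv_eq_fderiv (v := v)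
  rw [hder] at key
  calc ‖fderiv ℂ f z v‖ ≤ M / (r / ‖v‖) := key
    _ = M / r * ‖v‖ := by field_simp

theorem norm_sub_le_of_closedBall (hr : 0 < r)
    (hd : ∀ x ∈ closedBall z (2 * r), DifferentiableAt ℂ f x)
    (hb : ∀ x ∈ closedBall z (2 * r), ‖f x‖ ≤ M) (hw : ‖w - z‖ ≤ r) :
    ‖f w - f z‖ ≤ M / r * ‖w - z‖ := by
  let _ : NormedSpace ℝ E := NormedSpace.restrictScalars ℝ ℂ E
  have hsub : ∀ x ∈ closedBall z r, closedBall x r ⊆ closedBall z (2 * r) := fun x hx ↦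
    closedBall_subset_closedBall' (by rw [mem_closedBall] at hx; linarith)
  exact (convex_closedBall z r).norm_image_sub_le_of_norm_fderiv_le (𝕜 := ℂ)
    (fun x hx ↦ hd x (hsub x hx (mem_closedBall_self hr.le)))
    (fun x hx ↦ norm_fderiv_le_of_closedBall hr (fun y hy ↦ hd y (hsub x hx hy))
      (fun y hy ↦ hb y (hsub x hx hy)))
    (mem_closedBall_self hr.le) (by rwa [mem_closedBall_iff_norm])

/-- Cauchy's estimate for the second derivative, in the form of a Lipschitz bound: it is the first
order estimate applied to the difference `x ↦ f (x + (w - z)) - f x`. -/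
theorem norm_fderiv_sub_fderiv_le (hr : 0 < r)
    (hd : ∀ x ∈ closedBall z (3 * r), DifferentiableAt ℂ f x)
    (hb : ∀ x ∈ closedBall z (3 * r), ‖f x‖ ≤ M) (hw : ‖w - z‖ ≤ r) :
    ‖fderiv ℂ f w - fderiv ℂ f z‖ ≤ M / r ^ 2 * ‖w - z‖ := by
  let _ : NormedSpace ℝ E := NormedSpace.restrictScalars ℝ ℂ E
  have hsub : ∀ x ∈ closedBall z (2 * r), closedBall x r ⊆ closedBall z (3 * r) := fun x hx ↦
    closedBall_subset_closedBall' (by rw [mem_closedBall] at hx; linarith)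
  have hself : ∀ x ∈ closedBall z (2 * r), x ∈ closedBall z (3 * r) :=
    fun x hx ↦ hsub x hx (mem_closedBall_self hr.le)
  have h1 : ∀ x ∈ closedBall z (2 * r), ‖fderiv ℂ f x‖ ≤ M / r := fun x hx ↦
    norm_fderiv_le_of_closedBall hr (fun y hy ↦ hd y (hsub x hx hy))
      (fun y hy ↦ hb y (hsub x hx hy))
  have hmem : ∀ x ∈ closedBall z r, x ∈ closedBall z (2 * r) ∧
      x + (w - z) ∈ closedBall z (2 * r) := fun x hx ↦ by
    rw [mem_closedBall_iff_norm] at hx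
    refine ⟨?_, ?_⟩ <;> rw [mem_closedBall_iff_norm]
    · linarith
    · have : x + (w - z) - z = (x - z) + (w - z) := by abel
      rw [this]
      linarith [norm_add_le (x - z) (w - z)]
  have hadd : ∀ x, DifferentiableAt ℂ (fun y : E ↦ y + (w - z)) x := fun x ↦ by fun_prop
  have hcomp : ∀ x ∈ closedBall z r, DifferentiableAt ℂ (fun y ↦ f (y + (w - z))) x :=
    fun x hx ↦ DifferentiableAt.comp x (hd _ (hself _ (hmem x hx).2)) (hadd x)
  have h2 : ‖fderiv ℂ (fun x ↦ f (x + (w - z)) - f x) z‖ ≤ M / r * ‖w - z‖ / r := by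
    refine norm_fderiv_le_of_closedBall hr
      (fun x hx ↦ (hcomp x hx).sub (hd _ (hself _ (hmem x hx).1))) fun x hx ↦ ?_
    have := (convex_closedBall z (2 * r)).norm_image_sub_le_of_norm_fderiv_le (𝕜 := ℂ) (f := f)
      (fun y hy ↦ hd y (hself y hy)) h1 (hmem x hx).1 (hmem x hx).2
    simpa using this
  have hz : z ∈ closedBall z r := mem_closedBall_self hr.le
  have h3 : fderiv ℂ (fun x ↦ f (x + (w - z)) - f x) z = fderiv ℂ f w - fderiv ℂ f z := by
    rw [fderiv_fun_sub (hcomp z hz) (hd z (hself _ (hmem z hz).1)), fderiv_comp_add_right]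
    simp
  rw [h3] at h2
  calc _ ≤ _ := h2
    _ = _ := by field_simp

theorem norm_sub_sub_fderiv_le (hr : 0 < r)
    (hd : ∀ x ∈ closedBall z (3 * r), DifferentiableAt ℂ f x)
    (hb : ∀ x ∈ closedBall z (3 * r), ‖f x‖ ≤ M) (hw : ‖w - z‖ ≤ r) :
    ‖f w - f z - fderiv ℂ f z (w - z)‖ ≤ M / r ^ 2 * ‖w - z‖ ^ 2 := by
  let _ : NormedSpace ℝ E := NormedSpace.restrictScalars ℝ ℂ E
  have hM : 0 ≤ M := (norm_nonneg _).trans (hb z (mem_closedBall_self (by positivity)))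
  have := (convex_closedBall z ‖w - z‖).norm_image_sub_le_of_norm_fderiv_le' (𝕜 := ℂ) (f := f)
    (φ := fderiv ℂ f z) (C := M / r ^ 2 * ‖w - z‖) (x := z) (y := w)
    (fun x hx ↦ hd x (closedBall_subset_closedBall (by linarith) hx))
    (fun x hx ↦ by
      rw [mem_closedBall_iff_norm] at hx
      refine (norm_fderiv_sub_fderiv_le hr hd hb (hx.trans hw)).trans ?_
      gcongr)
    (mem_closedBall_self (norm_nonneg _)) (by simp [dist_eq_norm])
  calc _ ≤ _ := this
    _ = _ := by ring

end CauchyEstimates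

/-! ### The sub-mean value inequality -/

section MeanValue

variable {E : Type*} [NormedAddCommGroup E] [InnerProductSpace ℝ E] [NormedSpace ℂ E]
  [IsScalarTower ℝ ℂ E] [FiniteDimensional ℝ E] [MeasurableSpace E] [BorelSpace E]

/-- Multiplication by a unimodular complex number preserves the volume. -/
theorem measurePreserving_circle_smul (c : Circle) :
    MeasurePreserving (fun v : E ↦ (c : ℂ) • v) := by
  let e : E ≃ₗᵢ[ℝ] E :=
    { toLinearEquiv := LinearEquiv.ofLinearMap
        ((LinearMap.lsmul ℂ E (c : ℂ)).restrictScalars ℝ)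
        ((LinearMap.lsmul ℂ E ((c⁻¹ : Circle) : ℂ)).restrictScalars ℝ)
        (by ext v; simp [smul_smul]) (by ext v; simp [smul_smul])
      norm_map' := fun v ↦ by
        change ‖(c : ℂ) • v‖ = ‖v‖
        rw [norm_smul, Circle.norm_coe, one_mul] }
  exact e.measurePreserving

/-- The sub-mean value inequality for `|f|` on a ball of `ℂⁿ`, obtained by averaging the one
variable mean value property over all complex lines through the centre. -/
theorem enorm_mul_volume_ball_le {f : E → ℂ} {z : E} {R : ℝ}
    (hd : DifferentiableOn ℂ f (ball z R)) :
    ‖f z‖ₑ * volume (ball z R) ≤ ∫⁻ x in ball z R, ‖f x‖ₑ := by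
  set F : E → ENNReal := (ball z R).indicator fun x ↦ ‖f x‖ₑ with hF
  have hFm : Measurable F := by
    have h1 : F = fun x ↦ ‖(ball z R).indicator f x‖ₑ := by
      ext x; by_cases hx : x ∈ ball z R <;> simp [hF, hx]
    rw [h1]
    refine Measurable.enorm ?_
    classical
    rw [← piecewise_eq_indicator]
    exact hd.continuousOn.measurable_piecewise continuousOn_const measurableSet_ball
  have hline : ∀ v ∈ ball (0 : E) R, ‖f z‖ₑ * ENNReal.ofReal (2 * Real.pi) ≤
      ∫⁻ θ in Ioc 0 (2 * Real.pi), F (z + (Circle.exp θ : ℂ) • v) := fun v hv ↦ by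
    rw [mem_ball_zero_iff] at hv
    have hmem : ∀ t : ℂ, ‖t‖ ≤ 1 → z + t • v ∈ ball z R := fun t ht ↦ by
      rw [mem_ball_iff_norm, add_sub_cancel_left, norm_smul]
      exact lt_of_le_of_lt (mul_le_of_le_one_left (norm_nonneg _) ht) hv
    have hφ : ∀ t : ℂ, ‖t‖ ≤ 1 → DifferentiableAt ℂ (fun t : ℂ ↦ f (z + t • v)) t := fun t ht ↦
      DifferentiableAt.comp t (hd.differentiableAt (isOpen_ball.mem_nhds (hmem t ht)))
        (by fun_prop)
    have hmean := DiffContOnCl.circleAverage (c := 0) (R := 1) (f := fun t : ℂ ↦ f (z + t • v))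
      (DifferentiableOn.diffContOnCl fun t ht ↦ (hφ t (by
        simpa using closure_ball_subset_closedBall ht)).differentiableWithinAt)
    rw [Real.circleAverage_def, intervalIntegral.integral_of_le (by positivity)] at hmean
    have h2 : f z * (2 * Real.pi : ℝ) =
        ∫ θ in Ioc 0 (2 * Real.pi), f (z + (circleMap 0 1 θ) • v) := by
      simp only [zero_smul, add_zero] at hmean
      rw [← hmean, Complex.real_smul]
      push_cast
      field_simp
    calc ‖f z‖ₑ * ENNReal.ofReal (2 * Real.pi) = ‖f z * (2 * Real.pi : ℝ)‖ₑ := by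
          rw [enorm_mul, ← Real.enorm_of_nonneg (by positivity)]
          congr 1
          simp [enorm_eq_nnnorm]
      _ ≤ ∫⁻ θ in Ioc 0 (2 * Real.pi), ‖f (z + (circleMap 0 1 θ) • v)‖ₑ := by
          rw [h2]; exact enorm_integral_le_lintegral_enorm _
      _ ≤ _ := by
          refine lintegral_mono fun θ ↦ ?_
          have : z + (Circle.exp θ : ℂ) • v ∈ ball z R := hmem _ (by simp)
          simp only [hF, indicator_of_mem this]
          simp [circleMap]
  have hpi : ENNReal.ofReal (2 * Real.pi) ≠ 0 := by simp [Real.pi_pos]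
  rw [← ENNReal.mul_le_mul_iff_left hpi ENNReal.ofReal_ne_top]
  calc ‖f z‖ₑ * volume (ball z R) * ENNReal.ofReal (2 * Real.pi)
      = ∫⁻ _ in ball (0 : E) R, ‖f z‖ₑ * ENNReal.ofReal (2 * Real.pi) := by
        rw [setLIntegral_const, Measure.addHaar_ball_center volume z]; ring
    _ ≤ ∫⁻ v in ball (0 : E) R, ∫⁻ θ in Ioc 0 (2 * Real.pi), F (z + (Circle.exp θ : ℂ) • v) :=
        setLIntegral_mono' measurableSet_ball hline
    _ ≤ ∫⁻ v : E, ∫⁻ θ in Ioc 0 (2 * Real.pi), F (z + (Circle.exp θ : ℂ) • v) :=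
        setLIntegral_le_lintegral _ _
    _ = ∫⁻ θ in Ioc 0 (2 * Real.pi), ∫⁻ v : E, F (z + (Circle.exp θ : ℂ) • v) := by
        refine lintegral_lintegral_swap (Measurable.aemeasurable (hFm.comp ?_))
        exact Continuous.measurable (by fun_prop)
    _ = ∫⁻ _ in Ioc 0 (2 * Real.pi), ∫⁻ x in ball z R, ‖f x‖ₑ := by
        refine lintegral_congr fun θ ↦ ?_
        rw [(measurePreserving_circle_smul (E := E) (Circle.exp θ)).lintegral_comp
          (f := fun v ↦ F (z + v)) (hFm.comp (measurable_const_add z)),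
          lintegral_add_left_eq_self, lintegral_indicator measurableSet_ball]
    _ = _ := by
        rw [setLIntegral_const, Real.volume_Ioc, sub_zero]

/-- The sub-mean value inequality for `|f|^s`, `1 ≤ s`. -/
theorem norm_rpow_le_integral_ball {f : E → ℂ} {z : E} {R s : ℝ} (hR : 0 < R) (hs : 1 ≤ s)
    (hd : DifferentiableOn ℂ f (ball z R)) (hi : IntegrableOn (fun x ↦ ‖f x‖ ^ s) (ball z R)) :
    ‖f z‖ ^ s ≤ (volume.real (ball (0 : E) R))⁻¹ * ∫ x in ball z R, ‖f x‖ ^ s := by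
  have hvol : volume (ball z R) ≠ 0 := (measure_ball_pos volume z hR).ne'
  have hvol' : volume (ball z R) ≠ ⊤ := measure_ball_lt_top.ne
  have hfm : AEStronglyMeasurable f (volume.restrict (ball z R)) :=
    hd.continuousOn.aestronglyMeasurable measurableSet_ball
  have hf : IntegrableOn (fun x ↦ ‖f x‖) (ball z R) := by
    have hfin : IsFiniteMeasure (volume.restrict (ball z R)) :=
      ⟨by rw [Measure.restrict_apply_univ]; exact measure_ball_lt_top⟩
    refine Integrable.mono' ((integrable_const (1 : ℝ)).add hi) hfm.norm ?_
    refine Filter.Eventually.of_forall fun x ↦ ?_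
    rw [norm_norm]
    simp only [Pi.add_apply]
    rcases le_total ‖f x‖ 1 with h | h
    · have := Real.rpow_nonneg (norm_nonneg (f x)) s
      linarith
    · have := Real.self_le_rpow_of_one_le h hs
      linarith
  have h1 : ‖f z‖ ≤ ⨍ x in ball z R, ‖f x‖ := by
    have := enorm_mul_volume_ball_le hd
    rw [setAverage_eq, smul_eq_mul, ← div_eq_inv_mul, le_div_iff₀ (by
      exact ENNReal.toReal_pos hvol hvol')]
    rw [← ofReal_integral_norm_eq_lintegral_enorm (by exact (integrable_norm_iff hfm).1 hf)] at this
    have h2 := ENNReal.toReal_mono ENNReal.ofReal_ne_top this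
    rwa [ENNReal.toReal_mul, ENNReal.toReal_ofReal (integral_nonneg fun _ ↦ norm_nonneg _),
      toReal_enorm] at h2
  have h2 := (convexOn_rpow hs).map_set_average_le
    (Real.continuous_rpow_const (by linarith)).continuousOn isClosed_Ici hvol hvol'
    (Filter.Eventually.of_forall fun x ↦ norm_nonneg (f x)) hf hi
  calc ‖f z‖ ^ s ≤ (⨍ x in ball z R, ‖f x‖) ^ s :=
        Real.rpow_le_rpow (norm_nonneg _) h1 (by linarith)
    _ ≤ ⨍ x in ball z R, ‖f x‖ ^ s := h2
    _ = _ := by rw [setAverage_eq, smul_eq_mul, Measure.real, Measure.real,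
                  Measure.addHaar_ball_center volume z]

end MeanValue

/-! ### Quantitative strict convexity of `|·|^p` -/

section ConvexityDefect

/-- The defect in the midpoint convexity inequality for `|·|^p` on `ℂ`. -/
def convexityDefect (p : ℝ) (a b : ℂ) : ℝ := (‖a‖ ^ p + ‖b‖ ^ p) / 2 - ‖(a + b) / 2‖ ^ p

variable {p : ℝ}

theorem convexityDefect_comm (a b : ℂ) : convexityDefect p a b = convexityDefect p b a := by
  simp only [convexityDefect, add_comm]

theorem norm_half_add_sq (a b : ℂ) :
    ‖(a + b) / 2‖ ^ 2 + ‖a - b‖ ^ 2 / 4 = (‖a‖ ^ 2 + ‖b‖ ^ 2) / 2 := by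
  have := parallelogram_law_with_norm ℝ a b
  rw [norm_div, Complex.norm_ofNat]
  nlinarith

theorem norm_rpow_eq_sq_rpow (a : ℂ) (p : ℝ) : ‖a‖ ^ p = (‖a‖ ^ 2) ^ (p / 2) := by
  rw [← Real.rpow_natCast, ← Real.rpow_mul (norm_nonneg _)]
  congr 1
  push_cast
  ring

theorem le_convexityDefect_of_two_le (hp : 2 ≤ p) (a b : ℂ) :
    ((‖a‖ ^ 2 + ‖b‖ ^ 2) / 2) ^ (p / 2 - 1) * (‖a - b‖ ^ 2 / 4) ≤ convexityDefect p a b := by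
  set u := (‖a‖ ^ 2 + ‖b‖ ^ 2) / 2 with hu
  set x := ‖(a + b) / 2‖ ^ 2 with hx
  have hxu : x + ‖a - b‖ ^ 2 / 4 = u := norm_half_add_sq a b
  have hx0 : 0 ≤ x := sq_nonneg _
  have hu0 : 0 ≤ u := by positivity
  have h1 : u ^ (p / 2) ≤ (‖a‖ ^ p + ‖b‖ ^ p) / 2 := by
    have := (convexOn_rpow (p := p / 2) (by linarith)).2 (mem_Ici.2 (sq_nonneg ‖a‖))
      (mem_Ici.2 (sq_nonneg ‖b‖)) (by norm_num : (0 : ℝ) ≤ 1 / 2)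
      (by norm_num : (0 : ℝ) ≤ 1 / 2) (by norm_num)
    simp only [smul_eq_mul, ← norm_rpow_eq_sq_rpow] at this
    calc u ^ (p / 2) = (1 / 2 * ‖a‖ ^ 2 + 1 / 2 * ‖b‖ ^ 2) ^ (p / 2) := by rw [hu]; ring_nf
      _ ≤ _ := this
      _ = _ := by ring
  have hpow : ∀ y : ℝ, 0 ≤ y → y ^ (p / 2) = y ^ (p / 2 - 1) * y := fun y hy ↦ by
    rw [← Real.rpow_add_one' hy (by linarith), sub_add_cancel]
  have h2 : x ^ (p / 2) ≤ u ^ (p / 2 - 1) * x := by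
    rw [hpow x hx0]
    have : x ≤ u := by have := sq_nonneg ‖a - b‖; linarith
    gcongr
    linarith
  have h3 : u ^ (p / 2) = u ^ (p / 2 - 1) * x + u ^ (p / 2 - 1) * (‖a - b‖ ^ 2 / 4) := by
    rw [hpow u hu0, ← mul_add, hxu]
  rw [convexityDefect, norm_rpow_eq_sq_rpow ((a + b) / 2), ← hx]
  linarith

/-- For `p ≤ 2` the function `t ↦ t ^ p - c t ^ 2` is convex and nondecreasing on `[0, M]`, where
`c = p (p - 1) M ^ (p - 2) / 2`. Composed with the norm it is convex on the disc of radius `M`, and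
the parallelogram law gives the bound. -/
theorem le_convexityDefect_of_le_two (hp : 1 < p) (hp2 : p ≤ 2) {M : ℝ} (hM : 0 < M) {a b : ℂ}
    (ha : ‖a‖ ≤ M) (hb : ‖b‖ ≤ M) :
    p * (p - 1) / 2 * M ^ (p - 2) * (‖a - b‖ ^ 2 / 4) ≤ convexityDefect p a b := by
  set c := p * (p - 1) / 2 * M ^ (p - 2) with hc
  set g : ℝ → ℝ := fun t ↦ t ^ p - c * t ^ 2 with hg
  have hgc : ContinuousOn g (Icc 0 M) :=
    ((Real.continuous_rpow_const (by linarith)).sub (by fun_prop)).continuousOn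
  have hd1 : ∀ t ∈ Ioo 0 M, HasDerivAt g (p * t ^ (p - 1) - c * (2 * t)) t := fun t ht ↦ by
    have := (Real.hasDerivAt_rpow_const (p := p) (Or.inl ht.1.ne')).fun_sub
      ((hasDerivAt_pow 2 t).const_mul c)
    simpa using this
  have hd2 : ∀ t ∈ Ioo 0 M, HasDerivAt (fun t ↦ p * t ^ (p - 1) - c * (2 * t))
      (p * ((p - 1) * t ^ (p - 2)) - c * 2) t := fun t ht ↦ by
    have := ((Real.hasDerivAt_rpow_const (p := p - 1) (Or.inl ht.1.ne')).const_mul p).fun_sub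
      (((hasDerivAt_id t).const_mul 2).const_mul c)
    simpa [show p - 1 - 1 = p - 2 by ring] using this
  have hpow : ∀ t ∈ Ioo 0 M, M ^ (p - 2) ≤ t ^ (p - 2) := fun t ht ↦
    Real.rpow_le_rpow_of_nonpos ht.1 ht.2.le (by linarith)
  have hconv : ConvexOn ℝ (Icc 0 M) g := by
    refine convexOn_of_hasDerivWithinAt2_nonneg (convex_Icc 0 M) hgc
      (f' := fun t ↦ p * t ^ (p - 1) - c * (2 * t))
      (f'' := fun t ↦ p * ((p - 1) * t ^ (p - 2)) - c * 2) ?_ ?_ ?_ <;> rw [interior_Icc]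
    · exact fun t ht ↦ (hd1 t ht).hasDerivWithinAt
    · exact fun t ht ↦ (hd2 t ht).hasDerivWithinAt
    · intro t ht
      have : 0 ≤ p * (p - 1) * (t ^ (p - 2) - M ^ (p - 2)) :=
        mul_nonneg (mul_nonneg (by linarith) (by linarith)) (sub_nonneg.2 (hpow t ht))
      rw [hc]
      linarith
  have hmono : MonotoneOn g (Icc 0 M) := by
    refine monotoneOn_of_hasDerivWithinAt_nonneg (convex_Icc 0 M) hgc
      (f' := fun t ↦ p * t ^ (p - 1) - c * (2 * t)) ?_ ?_ <;> rw [interior_Icc]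
    · exact fun t ht ↦ (hd1 t ht).hasDerivWithinAt
    · intro t ht
      have h1 : t ^ (p - 1) = t ^ (p - 2) * t := by
        rw [← Real.rpow_add_one ht.1.ne']; congr 1; ring
      have h2 : 0 ≤ p * t * (t ^ (p - 2) - (p - 1) * M ^ (p - 2)) := by
        have h3 : (p - 1) * M ^ (p - 2) ≤ 1 * M ^ (p - 2) :=
          mul_le_mul_of_nonneg_right (by linarith) (by positivity)
        exact mul_nonneg (mul_nonneg (by linarith) ht.1.le) (by linarith [hpow t ht])
      rw [h1, hc]
      linarith
  have hab : ‖(a + b) / 2‖ ≤ (‖a‖ + ‖b‖) / 2 := by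
    rw [norm_div, Complex.norm_ofNat]
    linarith [norm_add_le a b]
  have h1 : g ‖(a + b) / 2‖ ≤ g ((‖a‖ + ‖b‖) / 2) :=
    hmono ⟨norm_nonneg _, by linarith⟩ ⟨by positivity, by linarith⟩ hab
  have h2 : g ((‖a‖ + ‖b‖) / 2) ≤ (g ‖a‖ + g ‖b‖) / 2 := by
    have := hconv.2 ⟨norm_nonneg a, ha⟩ ⟨norm_nonneg b, hb⟩ (by norm_num : (0 : ℝ) ≤ 1 / 2)
      (by norm_num : (0 : ℝ) ≤ 1 / 2) (by norm_num)
    simp only [smul_eq_mul] at this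
    calc g ((‖a‖ + ‖b‖) / 2) = g (1 / 2 * ‖a‖ + 1 / 2 * ‖b‖) := by ring_nf
      _ ≤ _ := this
      _ = _ := by ring
  have h3 : ‖a - b‖ ^ 2 / 4 = (‖a‖ ^ 2 + ‖b‖ ^ 2) / 2 - ‖(a + b) / 2‖ ^ 2 := by
    linarith [norm_half_add_sq a b]
  simp only [hg] at h1 h2
  rw [h3, convexityDefect]
  linarith

theorem convexityDefect_nonneg (hp : 1 < p) (a b : ℂ) : 0 ≤ convexityDefect p a b := by
  rcases le_total p 2 with h | h
  · refine le_trans ?_ (le_convexityDefect_of_le_two hp h (M := ‖a‖ + ‖b‖ + 1) (by positivity)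
      (by linarith [norm_nonneg b]) (by linarith [norm_nonneg a]))
    have : 0 ≤ p - 1 := by linarith
    positivity
  · exact le_trans (by positivity) (le_convexityDefect_of_two_le h a b)

/-- The quantitative strict convexity of `|·|^p` on bounded sets. -/
theorem exists_rpow_le_convexityDefect (hp : 1 < p) {M : ℝ} (hM : 0 < M) :
    ∃ s ≥ (1 : ℝ), ∃ c > 0, ∀ a b : ℂ, ‖a‖ ≤ M → ‖b‖ ≤ M →
      c * ‖a - b‖ ^ s ≤ convexityDefect p a b := by
  rcases le_total p 2 with h | h
  · refine ⟨2, by norm_num, p * (p - 1) / 2 * M ^ (p - 2) / 4, ?_, fun a b ha hb ↦ ?_⟩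
    · have : 0 < p - 1 := by linarith
      positivity
    · refine le_trans (le_of_eq ?_) (le_convexityDefect_of_le_two hp h hM ha hb)
      rw [Real.rpow_two]
      ring
  · refine ⟨p, hp.le, (1 / 4) ^ (p / 2 - 1) / 4, by positivity, fun a b _ _ ↦ ?_⟩
    refine le_trans ?_ (le_convexityDefect_of_two_le h a b)
    have h1 : 1 / 4 * ‖a - b‖ ^ 2 ≤ (‖a‖ ^ 2 + ‖b‖ ^ 2) / 2 := by
      linarith [norm_half_add_sq a b, sq_nonneg ‖(a + b) / 2‖]
    have h2 : ‖a - b‖ ^ p = (‖a - b‖ ^ 2) ^ (p / 2 - 1) * ‖a - b‖ ^ 2 := by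
      rw [← Real.rpow_add_one' (sq_nonneg _) (by linarith), sub_add_cancel, norm_rpow_eq_sq_rpow]
    calc _ = (1 / 4 * ‖a - b‖ ^ 2) ^ (p / 2 - 1) * (‖a - b‖ ^ 2 / 4) := by
          rw [h2, Real.mul_rpow (by norm_num) (sq_nonneg _)]; ring
      _ ≤ _ := by
          have : 0 ≤ p / 2 - 1 := by linarith
          gcongr

/-- Away from the origin `|·|^p` is uniformly convex with a quadratic modulus, for every
`1 < p < ∞`. This is what makes the exponent of regularity independent of `p`. -/
theorem exists_sq_le_convexityDefect (hp : 1 < p) {M : ℝ} (hM : 0 < M) :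
    ∃ c > 0, ∀ a b : ℂ, 1 / 2 ≤ ‖a‖ → ‖a‖ ≤ M → ‖b‖ ≤ M →
      c * ‖a - b‖ ^ (2 : ℝ) ≤ convexityDefect p a b := by
  simp only [Real.rpow_two]
  rcases le_total p 2 with h | h
  · refine ⟨p * (p - 1) / 2 * M ^ (p - 2) / 4, ?_, fun a b _ ha hb ↦ ?_⟩
    · have : 0 < p - 1 := by linarith
      positivity
    · exact le_trans (le_of_eq (by ring)) (le_convexityDefect_of_le_two hp h hM ha hb)
  · refine ⟨(1 / 8) ^ (p / 2 - 1) / 4, by positivity, fun a b ha _ _ ↦ ?_⟩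
    refine le_trans ?_ (le_convexityDefect_of_two_le h a b)
    have h1 : 1 / 8 ≤ (‖a‖ ^ 2 + ‖b‖ ^ 2) / 2 := by nlinarith [sq_nonneg ‖b‖]
    have : 0 ≤ p / 2 - 1 := by linarith
    calc _ = (1 / 8) ^ (p / 2 - 1) * (‖a - b‖ ^ 2 / 4) := by ring
      _ ≤ _ := by gcongr

end ConvexityDefect

/-! ### The Bergman space and the extremal problem -/

section BergmanSpace

variable {n : ℕ} {Ω : Set (EuclideanSpace ℂ (Fin n))} {p : ℝ}
  {f g : EuclideanSpace ℂ (Fin n) → ℂ} {z : EuclideanSpace ℂ (Fin n)}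

/-- The `p`-th power `∫_Ω |f|^p` of the norm of `A^p(Ω)`. -/
def energy (Ω : Set (EuclideanSpace ℂ (Fin n))) (p : ℝ) (f : EuclideanSpace ℂ (Fin n) → ℂ) : ℝ :=
  ∫ w in Ω, ‖f w‖ ^ p

/-- The infimum `m_p(z)^p` of `energy Ω p f` over all `f` in `A^p(Ω)` with `f z = 1`. -/
def minEnergy (Ω : Set (EuclideanSpace ℂ (Fin n))) (p : ℝ) (z : EuclideanSpace ℂ (Fin n)) : ℝ :=
  minNorm Ω p z ^ p

theorem energy_nonneg : 0 ≤ energy Ω p f :=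
  integral_nonneg fun _ ↦ Real.rpow_nonneg (norm_nonneg _) _

theorem bergmanNorm_nonneg : 0 ≤ bergmanNorm Ω p f := Real.rpow_nonneg energy_nonneg _

theorem minNorm_nonneg : 0 ≤ minNorm Ω p z :=
  Real.sInf_nonneg (by rintro _ ⟨f, _, _, rfl⟩; exact bergmanNorm_nonneg)

theorem minEnergy_nonneg : 0 ≤ minEnergy Ω p z := Real.rpow_nonneg minNorm_nonneg _

theorem kernel_eq_inv_minEnergy : kernel Ω p z = (minEnergy Ω p z)⁻¹ :=
  Real.rpow_neg minNorm_nonneg _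

theorem bergmanNorm_rpow (hp : 1 < p) : bergmanNorm Ω p f ^ p = energy Ω p f := by
  change (energy Ω p f ^ (1 / p)) ^ p = energy Ω p f
  rw [← Real.rpow_mul energy_nonneg, one_div, inv_mul_cancel₀ (by linarith), Real.rpow_one]

theorem memBergman_const (hbdd : Bornology.IsBounded Ω) (c : ℂ) :
    MemBergman Ω p (fun _ ↦ c) :=
  ⟨differentiableOn_const c, integrableOn_const hbdd.measure_lt_top.ne⟩

theorem MemBergman.const_mul (hf : MemBergman Ω p f) (c : ℂ) :
    MemBergman Ω p (fun w ↦ c * f w) := by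
  refine ⟨hf.1.const_mul c, ?_⟩
  have : (fun w ↦ ‖c * f w‖ ^ p) = fun w ↦ ‖c‖ ^ p * ‖f w‖ ^ p := by
    ext w; rw [norm_mul, Real.mul_rpow (norm_nonneg _) (norm_nonneg _)]
  rw [this]
  exact hf.2.const_mul _

theorem energy_const_mul (c : ℂ) : energy Ω p (fun w ↦ c * f w) = ‖c‖ ^ p * energy Ω p f := by
  rw [energy, energy, ← integral_const_mul]
  congr 1
  ext w
  rw [norm_mul, Real.mul_rpow (norm_nonneg _) (norm_nonneg _)]

theorem MemBergman.midpoint (hΩ : IsOpen Ω) (hp : 1 < p) (hf : MemBergman Ω p f)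
    (hg : MemBergman Ω p g) : MemBergman Ω p (fun w ↦ (f w + g w) / 2) := by
  have hd : DifferentiableOn ℂ (fun w ↦ (f w + g w) / 2) Ω := by
    simp only [div_eq_mul_inv]
    exact (hf.1.add hg.1).mul_const _
  refine ⟨hd, Integrable.mono' ((hf.2.add hg.2).div_const 2) ?_
    (Filter.Eventually.of_forall fun w ↦ ?_)⟩
  · exact ((hd.continuousOn.norm.rpow_const fun _ _ ↦ Or.inr (by linarith)).aestronglyMeasurable
      hΩ.measurableSet)
  · rw [Real.norm_of_nonneg (Real.rpow_nonneg (norm_nonneg _) _)]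
    have := convexityDefect_nonneg hp (f w) (g w)
    rw [convexityDefect] at this
    simp only [Pi.add_apply]
    linarith

theorem MemBergman.integrableOn_convexityDefect (hΩ : IsOpen Ω) (hp : 1 < p)
    (hf : MemBergman Ω p f) (hg : MemBergman Ω p g) :
    IntegrableOn (fun w ↦ convexityDefect p (f w) (g w)) Ω :=
  ((hf.2.add hg.2).div_const 2).sub (hf.midpoint hΩ hp hg).2

theorem integral_convexityDefect (hΩ : IsOpen Ω) (hp : 1 < p)
    (hf : MemBergman Ω p f) (hg : MemBergman Ω p g) :
    ∫ w in Ω, convexityDefect p (f w) (g w) =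
      (energy Ω p f + energy Ω p g) / 2 - energy Ω p (fun w ↦ (f w + g w) / 2) := by
  have h1 := (hf.midpoint hΩ hp hg).2
  have h2 : Integrable (fun w ↦ (‖f w‖ ^ p + ‖g w‖ ^ p) / 2) (volume.restrict Ω) :=
    (hf.2.add hg.2).div_const 2
  simp only [convexityDefect]
  rw [integral_sub h2 h1, integral_div, integral_add hf.2 hg.2]
  rfl

theorem minEnergy_le (hp : 1 < p) (hf : MemBergman Ω p f) (hz : f z = 1) :
    minEnergy Ω p z ≤ energy Ω p f := by
  rw [← bergmanNorm_rpow hp]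
  refine Real.rpow_le_rpow minNorm_nonneg (csInf_le ⟨0, ?_⟩ ⟨f, hf, hz, rfl⟩) (by linarith)
  rintro _ ⟨f, _, _, rfl⟩
  exact bergmanNorm_nonneg

theorem exists_energy_lt (hbdd : Bornology.IsBounded Ω) (hp : 1 < p) {ε : ℝ} (hε : 0 < ε) :
    ∃ f, MemBergman Ω p f ∧ f z = 1 ∧ energy Ω p f < minEnergy Ω p z + ε := by
  have hp0 : 0 < p := by linarith
  have h0 := minEnergy_nonneg (Ω := Ω) (p := p) (z := z)
  have hlt : minNorm Ω p z < (minEnergy Ω p z + ε) ^ p⁻¹ := by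
    rw [Real.lt_rpow_inv_iff_of_pos minNorm_nonneg (by linarith) hp0]
    change minEnergy Ω p z < _
    linarith
  obtain ⟨_, ⟨f, hf, hz, rfl⟩, h⟩ := exists_lt_of_csInf_lt
    (by exact ⟨_, fun _ ↦ 1, memBergman_const hbdd 1, rfl, rfl⟩) hlt
  refine ⟨f, hf, hz, ?_⟩
  rw [Real.lt_rpow_inv_iff_of_pos bergmanNorm_nonneg (by linarith) hp0] at h
  rwa [← bergmanNorm_rpow hp]

theorem isMinimizer_iff (hp : 1 < p) :
    IsMinimizer Ω p z f ↔ MemBergman Ω p f ∧ f z = 1 ∧ energy Ω p f = minEnergy Ω p z := by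
  rw [IsMinimizer, ← bergmanNorm_rpow hp, minEnergy,
    Real.rpow_left_inj bergmanNorm_nonneg minNorm_nonneg (by linarith)]

/-- The homogeneous form of the extremal problem. -/
theorem norm_rpow_mul_minEnergy_le (hp : 1 < p) (hf : MemBergman Ω p f) :
    ‖f z‖ ^ p * minEnergy Ω p z ≤ energy Ω p f := by
  rcases eq_or_ne (f z) 0 with h | h
  · rw [h, norm_zero, Real.zero_rpow (by linarith), zero_mul]
    exact energy_nonneg
  · have h1 := minEnergy_le (z := z) hp (hf.const_mul (f z)⁻¹) (inv_mul_cancel₀ h)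
    rw [energy_const_mul, norm_inv, Real.inv_rpow (norm_nonneg _)] at h1
    have : 0 < ‖f z‖ ^ p := Real.rpow_pos_of_pos (norm_pos_iff.2 h) _
    rwa [← div_eq_inv_mul, le_div_iff₀ this, mul_comm] at h1

/-- The extremal property at `z`, tested on the midpoint of `f` and `g`, controls the total
convexity defect of the two functions. -/
theorem integral_convexityDefect_le (hΩ : IsOpen Ω) (hp : 1 < p) (hf : MemBergman Ω p f)
    (hg : MemBergman Ω p g) (z : EuclideanSpace ℂ (Fin n)) :
    ∫ w in Ω, convexityDefect p (f w) (g w) ≤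
      (energy Ω p f + energy Ω p g) / 2 - ‖(f z + g z) / 2‖ ^ p * minEnergy Ω p z := by
  rw [integral_convexityDefect hΩ hp hf hg]
  linarith [norm_rpow_mul_minEnergy_le (z := z) hp (hf.midpoint hΩ hp hg)]

theorem norm_rpow_le_energy (hp : 1 < p) (hf : MemBergman Ω p f) {R : ℝ}
    (hR : 0 < R) (hz : ball z R ⊆ Ω) :
    ‖f z‖ ^ p ≤ (volume.real (ball (0 : EuclideanSpace ℂ (Fin n)) R))⁻¹ * energy Ω p f := by
  refine (norm_rpow_le_integral_ball hR hp.le (hf.1.mono hz) (hf.2.mono_set hz)).trans ?_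
  gcongr
  exact setIntegral_mono_set hf.2
    (Filter.Eventually.of_forall fun _ ↦ Real.rpow_nonneg (norm_nonneg _) _) hz.eventuallyLE

/-- Functions of bounded energy are bounded, uniformly at a given distance from the boundary. -/
theorem exists_norm_le_of_energy_le (hp : 1 < p) {R : ℝ} (hR : 0 < R) (V : ℝ) :
    ∃ M > 0, ∀ f, MemBergman Ω p f → energy Ω p f ≤ V → ∀ z, ball z R ⊆ Ω → ‖f z‖ ≤ M := by
  set v := volume.real (ball (0 : EuclideanSpace ℂ (Fin n)) R) with hv
  have hp0 : 0 < p := by linarith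
  refine ⟨(v⁻¹ * |V| + 1) ^ p⁻¹, by positivity, fun f hf hV z hz ↦ ?_⟩
  rw [Real.le_rpow_inv_iff_of_pos (norm_nonneg _) (by positivity) hp0]
  have h1 := norm_rpow_le_energy hp hf hR hz
  have h2 : v⁻¹ * energy Ω p f ≤ v⁻¹ * |V| := by
    gcongr
    exact hV.trans (le_abs_self V)
  linarith

theorem norm_sub_rpow_le_integral_convexityDefect (hΩ : IsOpen Ω) (hp : 1 < p)
    (hf : MemBergman Ω p f) (hg : MemBergman Ω p g) {R s c : ℝ} (hR : 0 < R) (hs : 1 ≤ s)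
    (hc : 0 < c) (hz : ball z R ⊆ Ω)
    (h : ∀ x ∈ ball z R, c * ‖f x - g x‖ ^ s ≤ convexityDefect p (f x) (g x)) :
    ‖f z - g z‖ ^ s ≤ (volume.real (ball (0 : EuclideanSpace ℂ (Fin n)) R))⁻¹ *
      (c⁻¹ * ∫ w in Ω, convexityDefect p (f w) (g w)) := by
  have hd : DifferentiableOn ℂ (fun x ↦ f x - g x) (ball z R) := (hf.1.sub hg.1).mono hz
  have hD := hf.integrableOn_convexityDefect hΩ hp hg
  have hle : ∀ x ∈ ball z R, ‖f x - g x‖ ^ s ≤ c⁻¹ * convexityDefect p (f x) (g x) :=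
    fun x hx ↦ by
      rw [← div_eq_inv_mul, le_div_iff₀ hc, mul_comm]
      exact h x hx
  have hD' : IntegrableOn (fun x ↦ c⁻¹ * convexityDefect p (f x) (g x)) (ball z R) :=
    (hD.mono_set hz).const_mul _
  have hi : IntegrableOn (fun x ↦ ‖f x - g x‖ ^ s) (ball z R) := by
    refine Integrable.mono' hD' ?_ ?_
    · exact ((hd.continuousOn.norm.rpow_const fun _ _ ↦ Or.inr
        (by linarith)).aestronglyMeasurable measurableSet_ball)
    · refine (ae_restrict_iff' measurableSet_ball).2 (Filter.Eventually.of_forall fun x hx ↦ ?_)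
      rw [Real.norm_of_nonneg (Real.rpow_nonneg (norm_nonneg _) _)]
      exact hle x hx
  refine (norm_rpow_le_integral_ball hR hs hd hi).trans ?_
  gcongr
  calc ∫ x in ball z R, ‖f x - g x‖ ^ s
      ≤ ∫ x in ball z R, c⁻¹ * convexityDefect p (f x) (g x) :=
        setIntegral_mono_on hi hD' measurableSet_ball hle
    _ ≤ ∫ x in Ω, c⁻¹ * convexityDefect p (f x) (g x) :=
        setIntegral_mono_set (hD.const_mul _) (Filter.Eventually.of_forall fun x ↦
          mul_nonneg (inv_nonneg.2 hc.le) (convexityDefect_nonneg hp _ _)) hz.eventuallyLE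
    _ = _ := integral_const_mul _ _

/-- On a small ball around any point of `Ω`, some power of the difference of two functions of
bounded energy is controlled by their total convexity defect. -/
theorem exists_ball_norm_sub_rpow_le (hΩ : IsOpen Ω) (hp : 1 < p) (hz : z ∈ Ω) (V : ℝ) :
    ∃ r > 0, ∃ s ≥ (1 : ℝ), ∃ C > 0, ball z r ⊆ Ω ∧ ∀ f g, MemBergman Ω p f → MemBergman Ω p g →
      energy Ω p f ≤ V → energy Ω p g ≤ V → ∀ x ∈ ball z r,
        ‖f x - g x‖ ^ s ≤ C * ∫ w in Ω, convexityDefect p (f w) (g w) := by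
  obtain ⟨ε, hε, hball⟩ := Metric.isOpen_iff.1 hΩ z hz
  have hr : 0 < ε / 3 := by positivity
  obtain ⟨M, hM, hb⟩ := exists_norm_le_of_energy_le hp hr V
  obtain ⟨s, hs, c, hc, hdef⟩ := exists_rpow_le_convexityDefect hp hM
  have hvol : 0 < volume.real (ball (0 : EuclideanSpace ℂ (Fin n)) (ε / 3)) :=
    ENNReal.toReal_pos (measure_ball_pos _ _ hr).ne' measure_ball_lt_top.ne
  refine ⟨ε / 3, hr, s, hs, _, mul_pos (inv_pos.2 hvol) (inv_pos.2 hc),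
    (ball_subset_ball (by linarith)).trans hball, fun f g hf hg hfV hgV x hx ↦ ?_⟩
  have h1 : ∀ y ∈ ball x (ε / 3), ball y (ε / 3) ⊆ Ω := fun y hy ↦
    (ball_subset_ball' (by
      rw [mem_ball] at hx hy
      linarith [dist_triangle y x z])).trans hball
  rw [mul_assoc]
  exact norm_sub_rpow_le_integral_convexityDefect hΩ hp hf hg hr hs hc
    (h1 x (mem_ball_self hr)) fun y hy ↦
      hdef _ _ (hb f hf hfV y (h1 y hy)) (hb g hg hgV y (h1 y hy))

end BergmanSpace

/-! ### Uniform limits of holomorphic functions -/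

section UniformLimits

variable {E : Type*} [NormedAddCommGroup E] [NormedSpace ℂ E]

/-- Weierstrass' theorem on uniform limits of holomorphic functions, in several variables: by
Cauchy's estimate the derivatives converge locally uniformly. -/
theorem differentiableAt_of_uniformCauchySeqOn {g : ℕ → E → ℂ} {f : E → ℂ} {z : E} {r : ℝ}
    (hr : 0 < r) (hd : ∀ k, DifferentiableOn ℂ (g k) (ball z r))
    (hc : UniformCauchySeqOn g atTop (ball z r))
    (ht : ∀ x ∈ ball z r, Tendsto (fun k ↦ g k x) atTop (𝓝 (f x))) : DifferentiableAt ℂ f z := by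
  have hda : ∀ k, ∀ x ∈ ball z r, DifferentiableAt ℂ (g k) x :=
    fun k x hx ↦ (hd k).differentiableAt (isOpen_ball.mem_nhds hx)
  have hsub : ball z (r / 2) ⊆ ball z r := ball_subset_ball (by linarith)
  have hcauchy : UniformCauchySeqOn (fun k ↦ fderiv ℂ (g k)) atTop (ball z (r / 2)) := by
    rw [Metric.uniformCauchySeqOn_iff] at hc ⊢
    intro ε hε
    obtain ⟨N, hN⟩ := hc (ε * r / 8) (by positivity)
    refine ⟨N, fun k hk l hl x hx ↦ ?_⟩
    have hx' : closedBall x (r / 4) ⊆ ball z r := closedBall_subset_ball' (by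
      rw [mem_ball] at hx; linarith)
    have h1 := norm_fderiv_le_of_closedBall (f := fun y ↦ g k y - g l y) (z := x) (r := r / 4)
      (M := ε * r / 8) (by positivity)
      (fun y hy ↦ (hda k y (hx' hy)).sub (hda l y (hx' hy)))
      (fun y hy ↦ by rw [← dist_eq_norm]; exact (hN k hk l hl y (hx' hy)).le)
    rw [fderiv_fun_sub (hda k x (hsub hx)) (hda l x (hsub hx))] at h1
    rw [dist_eq_norm]
    calc _ ≤ _ := h1
      _ = ε / 2 := by field_simp; norm_num
      _ < ε := by linarith
  have hlim : ∀ x : E, ∃ L : E →L[ℂ] ℂ, x ∈ ball z (r / 2) →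
      Tendsto (fun k ↦ fderiv ℂ (g k) x) atTop (𝓝 L) := fun x ↦ by
    by_cases hx : x ∈ ball z (r / 2)
    · obtain ⟨L, hL⟩ := cauchySeq_tendsto_of_complete (hcauchy.cauchySeq hx)
      exact ⟨L, fun _ ↦ hL⟩
    · exact ⟨0, fun h ↦ absurd h hx⟩
  choose f' hf' using hlim
  exact (hasFDerivAt_of_tendstoUniformlyOn isOpen_ball
    (hcauchy.tendstoUniformlyOn_of_tendsto hf')
    (fun k x hx ↦ (hda k x (hsub hx)).hasFDerivAt) (fun x hx ↦ ht x (hsub hx))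
    (mem_ball_self (by positivity))).differentiableAt

end UniformLimits

/-! ### Existence and uniqueness of the minimizer -/

section Minimizers

variable {n : ℕ} {Ω : Set (EuclideanSpace ℂ (Fin n))} {p : ℝ}
  {f g : EuclideanSpace ℂ (Fin n) → ℂ} {z : EuclideanSpace ℂ (Fin n)}

/-- A pointwise limit of functions whose energies converge has at most the limiting energy. -/
theorem integrableOn_and_energy_le_of_tendsto (hΩ : IsOpen Ω) (hp : 1 < p)
    {g : ℕ → EuclideanSpace ℂ (Fin n) → ℂ} {A : ℝ} (hg : ∀ k, MemBergman Ω p (g k))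
    (hA : Tendsto (fun k ↦ energy Ω p (g k)) atTop (𝓝 A)) (hfc : ContinuousOn f Ω)
    (hf : ∀ x ∈ Ω, Tendsto (fun k ↦ g k x) atTop (𝓝 (f x))) :
    IntegrableOn (fun w ↦ ‖f w‖ ^ p) Ω ∧ energy Ω p f ≤ A := by
  have hp0 : 0 ≤ p := by linarith
  have hA0 : 0 ≤ A := ge_of_tendsto' hA fun _ ↦ energy_nonneg
  have hnn : ∀ u : EuclideanSpace ℂ (Fin n) → ℂ,
      0 ≤ᵐ[volume.restrict Ω] fun w ↦ ‖u w‖ ^ p :=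
    fun u ↦ Eventually.of_forall fun _ ↦ Real.rpow_nonneg (norm_nonneg _) _
  have hmeas : AEStronglyMeasurable (fun w ↦ ‖f w‖ ^ p) (volume.restrict Ω) :=
    (hfc.norm.rpow_const fun _ _ ↦ Or.inr hp0).aestronglyMeasurable hΩ.measurableSet
  have hle : ∫⁻ w in Ω, ENNReal.ofReal (‖f w‖ ^ p) ≤ ENNReal.ofReal A := by
    calc ∫⁻ w in Ω, ENNReal.ofReal (‖f w‖ ^ p)
        = ∫⁻ w in Ω, liminf (fun k ↦ ENNReal.ofReal (‖g k w‖ ^ p)) atTop := by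
          refine setLIntegral_congr_fun hΩ.measurableSet fun w hw ↦ ?_
          refine (Tendsto.liminf_eq ?_).symm
          exact (ENNReal.continuous_ofReal.tendsto _).comp
            ((hf w hw).norm.rpow_const (Or.inr hp0))
      _ ≤ liminf (fun k ↦ ∫⁻ w in Ω, ENNReal.ofReal (‖g k w‖ ^ p)) atTop :=
          lintegral_liminf_le' fun k ↦ (hg k).2.aestronglyMeasurable.aemeasurable.ennreal_ofReal
      _ = ENNReal.ofReal A := by
          refine Tendsto.liminf_eq ?_
          have : ∀ k, ∫⁻ w in Ω, ENNReal.ofReal (‖g k w‖ ^ p) = ENNReal.ofReal (energy Ω p (g k)) :=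
            fun k ↦ (ofReal_integral_eq_lintegral_ofReal (hg k).2 (hnn _)).symm
          simp only [this]
          exact (ENNReal.continuous_ofReal.tendsto _).comp hA
  have hint : IntegrableOn (fun w ↦ ‖f w‖ ^ p) Ω := by
    refine ⟨hmeas, ?_⟩
    rw [hasFiniteIntegral_iff_ofReal (hnn f)]
    exact hle.trans_lt ENNReal.ofReal_lt_top
  refine ⟨hint, ?_⟩
  rw [← ofReal_integral_eq_lintegral_ofReal hint (hnn f)] at hle
  exact (ENNReal.ofReal_le_ofReal_iff hA0).1 hle

/-- Existence of the minimizer. The midpoint of two members of a minimizing sequence is again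
admissible, so their convexity defects tend to zero and the sequence converges locally uniformly. -/
theorem exists_isMinimizer (hΩ : IsOpen Ω) (hbdd : Bornology.IsBounded Ω) (hp : 1 < p)
    (hz : z ∈ Ω) : ∃ f, IsMinimizer Ω p z f := by
  set A := minEnergy Ω p z with hA
  have hex : ∀ k : ℕ, ∃ f, MemBergman Ω p f ∧ f z = 1 ∧ energy Ω p f < A + 1 / ((k : ℝ) + 1) :=
    fun k ↦ exists_energy_lt hbdd hp (by positivity)
  choose g hgm hgz hgA using hex
  have hV : ∀ k, energy Ω p (g k) ≤ A + 1 := fun k ↦ by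
    have : 1 / ((k : ℝ) + 1) ≤ 1 := by
      rw [div_le_one (by positivity)]
      linarith [(Nat.cast_nonneg k : (0 : ℝ) ≤ k)]
    linarith [hgA k]
  have hdef : ∀ N k l : ℕ, N ≤ k → N ≤ l →
      ∫ w in Ω, convexityDefect p (g k w) (g l w) ≤ 1 / ((N : ℝ) + 1) := fun N k l hk hl ↦ by
    have h1 := integral_convexityDefect_le hΩ hp (hgm k) (hgm l) z
    rw [hgz, hgz, show (1 + 1 : ℂ) / 2 = 1 by norm_num, norm_one, Real.one_rpow, one_mul] at h1
    have h2 := Nat.one_div_le_one_div (α := ℝ) hk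
    have h3 := Nat.one_div_le_one_div (α := ℝ) hl
    linarith [hgA k, hgA l]
  have hloc : ∀ x ∈ Ω, ∃ r > 0, ball x r ⊆ Ω ∧ UniformCauchySeqOn g atTop (ball x r) := by
    intro x hx
    obtain ⟨r, hr, s, hs, C, hC, hsub, h⟩ := exists_ball_norm_sub_rpow_le hΩ hp hx (A + 1)
    refine ⟨r, hr, hsub, ?_⟩
    rw [Metric.uniformCauchySeqOn_iff]
    intro ε hε
    obtain ⟨N, hN⟩ := exists_nat_one_div_lt (K := ℝ) (ε := ε ^ s / C) (by positivity)
    refine ⟨N, fun k hk l hl y hy ↦ ?_⟩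
    have h1 := h (g k) (g l) (hgm k) (hgm l) (hV k) (hV l) y hy
    have h2 : ‖g k y - g l y‖ ^ s < ε ^ s := by
      calc _ ≤ _ := h1
        _ ≤ C * (1 / ((N : ℝ) + 1)) := by gcongr; exact hdef N k l hk hl
        _ < C * (ε ^ s / C) := by gcongr
        _ = ε ^ s := by field_simp
    rw [dist_eq_norm]
    exact (Real.rpow_lt_rpow_iff (norm_nonneg _) hε.le (by linarith)).1 h2
  have hlim : ∀ x, ∃ L : ℂ, x ∈ Ω → Tendsto (fun k ↦ g k x) atTop (𝓝 L) := fun x ↦ by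
    by_cases hx : x ∈ Ω
    · obtain ⟨r, hr, -, hc⟩ := hloc x hx
      obtain ⟨L, hL⟩ := cauchySeq_tendsto_of_complete (hc.cauchySeq (mem_ball_self hr))
      exact ⟨L, fun _ ↦ hL⟩
    · exact ⟨0, fun h ↦ absurd h hx⟩
  choose f hf using hlim
  have hfd : DifferentiableOn ℂ f Ω := fun x hx ↦ by
    obtain ⟨r, hr, hsub, hc⟩ := hloc x hx
    exact (differentiableAt_of_uniformCauchySeqOn hr (fun k ↦ (hgm k).1.mono hsub) hc
      fun y hy ↦ hf y (hsub hy)).differentiableWithinAt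
  have hfz : f z = 1 := tendsto_nhds_unique (hf z hz) (by simp [hgz])
  have hAlim : Tendsto (fun k ↦ energy Ω p (g k)) atTop (𝓝 A) := by
    refine tendsto_of_tendsto_of_tendsto_of_le_of_le tendsto_const_nhds ?_
      (fun k ↦ minEnergy_le hp (hgm k) (hgz k)) (fun k ↦ (hgA k).le)
    simpa using tendsto_const_nhds.add (tendsto_one_div_add_atTop_nhds_zero_nat (𝕜 := ℝ))
  obtain ⟨hint, hle⟩ := integrableOn_and_energy_le_of_tendsto hΩ hp hgm hAlim hfd.continuousOn hf
  exact ⟨f, (isMinimizer_iff hp).2 ⟨⟨hfd, hint⟩, hfz,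
    le_antisymm hle (minEnergy_le hp ⟨hfd, hint⟩ hfz)⟩⟩

theorem IsMinimizer.eqOn (hΩ : IsOpen Ω) (hp : 1 < p) (hf : IsMinimizer Ω p z f)
    (hg : IsMinimizer Ω p z g) : EqOn f g Ω := by
  obtain ⟨hfm, hfz, hfA⟩ := (isMinimizer_iff hp).1 hf
  obtain ⟨hgm, hgz, hgA⟩ := (isMinimizer_iff hp).1 hg
  intro x hx
  have h1 := integral_convexityDefect_le hΩ hp hfm hgm z
  rw [hfz, hgz, show (1 + 1 : ℂ) / 2 = 1 by norm_num, norm_one, Real.one_rpow, one_mul,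
    hfA, hgA] at h1
  obtain ⟨r, hr, s, hs, C, hC, -, h⟩ := exists_ball_norm_sub_rpow_le hΩ hp hx (minEnergy Ω p z)
  have h2 : ‖f x - g x‖ ^ s ≤ 0 :=
    (h f g hfm hgm hfA.le hgA.le x (mem_ball_self hr)).trans
      (mul_nonpos_of_nonneg_of_nonpos hC.le (by linarith))
  by_contra hne
  exact absurd (Real.rpow_pos_of_pos (norm_pos_iff.2 (sub_ne_zero.2 hne)) s) (not_lt.2 h2)

theorem isMinimizer_minimizer (hΩ : IsOpen Ω) (hbdd : Bornology.IsBounded Ω) (hp : 1 < p)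
    (hz : z ∈ Ω) : IsMinimizer Ω p z (minimizer Ω p z) := by
  have h := exists_isMinimizer hΩ hbdd hp hz
  rw [minimizer, dif_pos h]
  exact h.choose_spec

end Minimizers

/-! ### Dependence of the minimizer on the point -/

section LocalEstimates

variable {n : ℕ} {Ω S : Set (EuclideanSpace ℂ (Fin n))} {p : ℝ}
  {z w : EuclideanSpace ℂ (Fin n)}

theorem memBergman_minimizer (hΩ : IsOpen Ω) (hbdd : Bornology.IsBounded Ω) (hp : 1 < p)
    (hz : z ∈ Ω) : MemBergman Ω p (minimizer Ω p z) :=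
  (isMinimizer_minimizer hΩ hbdd hp hz).1

theorem minimizer_self (hΩ : IsOpen Ω) (hbdd : Bornology.IsBounded Ω) (hp : 1 < p)
    (hz : z ∈ Ω) : minimizer Ω p z z = 1 :=
  (isMinimizer_minimizer hΩ hbdd hp hz).2.1

theorem energy_minimizer (hΩ : IsOpen Ω) (hbdd : Bornology.IsBounded Ω) (hp : 1 < p)
    (hz : z ∈ Ω) : energy Ω p (minimizer Ω p z) = minEnergy Ω p z :=
  ((isMinimizer_iff hp).1 (isMinimizer_minimizer hΩ hbdd hp hz)).2.2

theorem differentiableAt_minimizer (hΩ : IsOpen Ω) (hbdd : Bornology.IsBounded Ω) (hp : 1 < p)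
    (hz : z ∈ Ω) (hw : w ∈ Ω) : DifferentiableAt ℂ (minimizer Ω p z) w :=
  (memBergman_minimizer hΩ hbdd hp hz).1.differentiableAt (hΩ.mem_nhds hw)

theorem minEnergy_le_energy_one (hbdd : Bornology.IsBounded Ω) (hp : 1 < p) :
    minEnergy Ω p z ≤ energy Ω p (fun _ ↦ 1) :=
  minEnergy_le hp (memBergman_const hbdd 1) rfl

theorem volume_ball_le_minEnergy (hΩ : IsOpen Ω) (hbdd : Bornology.IsBounded Ω) (hp : 1 < p)
    {r : ℝ} (hr : 0 < r) (hz : ball z r ⊆ Ω) :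
    volume.real (ball (0 : EuclideanSpace ℂ (Fin n)) r) ≤ minEnergy Ω p z := by
  have hzΩ := hz (mem_ball_self hr)
  have h := norm_rpow_le_energy hp (memBergman_minimizer hΩ hbdd hp hzΩ) hr hz
  have hvol : 0 < volume.real (ball (0 : EuclideanSpace ℂ (Fin n)) r) :=
    ENNReal.toReal_pos (measure_ball_pos _ _ hr).ne' measure_ball_lt_top.ne
  rw [minimizer_self hΩ hbdd hp hzΩ, norm_one, Real.one_rpow, energy_minimizer hΩ hbdd hp hzΩ,
    ← div_eq_inv_mul, le_div_iff₀ hvol, one_mul] at h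
  exact h

theorem minEnergy_pos (hΩ : IsOpen Ω) (hbdd : Bornology.IsBounded Ω) (hp : 1 < p) (hz : z ∈ Ω) :
    0 < minEnergy Ω p z := by
  obtain ⟨r, hr, h⟩ := Metric.isOpen_iff.1 hΩ z hz
  exact (ENNReal.toReal_pos (measure_ball_pos volume (0 : EuclideanSpace ℂ (Fin n)) hr).ne'
    measure_ball_lt_top.ne).trans_le (volume_ball_le_minEnergy hΩ hbdd hp hr h)

/-- All minimizers are bounded by one constant near a compact set. -/
theorem exists_norm_minimizer_le (hΩ : IsOpen Ω) (hbdd : Bornology.IsBounded Ω) (hp : 1 < p)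
    (hS : IsCompact S) (hSΩ : S ⊆ Ω) :
    ∃ r > 0, r ≤ 1 ∧ ∃ M ≥ (1 : ℝ), ∀ z ∈ S, closedBall z (3 * r) ⊆ Ω ∧
      ∀ w ∈ Ω, ∀ x ∈ closedBall z (3 * r), ‖minimizer Ω p w x‖ ≤ M := by
  obtain ⟨δ, hδ, hsub⟩ := hS.exists_cthickening_subset_open hΩ hSΩ
  set r := min (δ / 4) 1 with hr_def
  have hr : 0 < r := by positivity
  have hrδ : 4 * r ≤ δ := by linarith [min_le_left (δ / 4) 1]
  obtain ⟨M, hM, hb⟩ := exists_norm_le_of_energy_le hp hr (Ω := Ω) (energy Ω p fun _ ↦ 1)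
  have hball : ∀ z ∈ S, closedBall z (4 * r) ⊆ Ω := fun z hz ↦
    (closedBall_subset_closedBall hrδ).trans ((closedBall_subset_cthickening hz δ).trans hsub)
  refine ⟨r, hr, min_le_right _ _, max M 1, le_max_right _ _, fun z hz ↦
    ⟨(closedBall_subset_closedBall (by linarith)).trans (hball z hz), fun w hw x hx ↦ ?_⟩⟩
  refine le_max_of_le_left (hb _ (memBergman_minimizer hΩ hbdd hp hw) ?_ x ?_)
  · rw [energy_minimizer hΩ hbdd hp hw]
    exact minEnergy_le_energy_one hbdd hp
  · exact (ball_subset_closedBall.trans (closedBall_subset_closedBall' (by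
      rw [mem_closedBall] at hx; linarith))).trans (hball z hz)

/-- The functions `m_p(·, z)` depend on `z` in a Hölder continuous way of order `1/2`, together with
their derivatives at `z`. Testing the extremal property at the point with the larger minimal energy
on the midpoint of `m_p(·, z)` and `m_p(·, w)` bounds their convexity defect by `O(|w - z|)`. Near
`z` the function `m_p(·, z)` has no zeros, so the defect dominates `|m_p(·, z) - m_p(·, w)|²`
there. -/
theorem exists_norm_fderiv_minimizer_sub_le (hΩ : IsOpen Ω) (hbdd : Bornology.IsBounded Ω)
    (hp : 1 < p) (hS : IsCompact S) (hSΩ : S ⊆ Ω) :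
    ∃ δ > 0, ∃ C ≥ (0 : ℝ), ∀ z ∈ S, ∀ w ∈ S, ‖w - z‖ ≤ δ →
      ‖fderiv ℂ (minimizer Ω p w) w - fderiv ℂ (minimizer Ω p z) z‖ ≤ C * √‖w - z‖ := by
  obtain ⟨r, hr, hr1, M, hM, hb⟩ := exists_norm_minimizer_le hΩ hbdd hp hS hSΩ
  have hM0 : 0 < M := by linarith
  have hd : ∀ z ∈ S, ∀ w ∈ Ω, ∀ x ∈ closedBall z (3 * r),
      DifferentiableAt ℂ (minimizer Ω p w) x := fun z hz w hw x hx ↦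
    differentiableAt_minimizer hΩ hbdd hp hw ((hb z hz).1 hx)
  have hlip : ∀ z ∈ S, ∀ x, ‖x - z‖ ≤ r →
      ‖minimizer Ω p z x - 1‖ ≤ M / r * ‖x - z‖ := fun z hz x hx ↦ by
    have h23 : closedBall z (2 * r) ⊆ closedBall z (3 * r) :=
      closedBall_subset_closedBall (by linarith)
    have := norm_sub_le_of_closedBall hr (fun y hy ↦ hd z hz z (hSΩ hz) y (h23 hy))
      (fun y hy ↦ (hb z hz).2 z (hSΩ hz) y (h23 hy)) hx
    rwa [minimizer_self hΩ hbdd hp (hSΩ hz)] at this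
  -- on the ball of radius `ρ` about `z` the Lipschitz bound keeps `m_p(·, z)` within `1/2` of `1`
  set ρ := r / (2 * M) with hρ_def
  have hρ : 0 < ρ := by positivity
  have hρr : ρ ≤ r := div_le_self hr.le (by linarith)
  have hMρ : M / r * ρ = 1 / 2 := by rw [hρ_def]; field_simp
  set V := energy Ω p (fun _ ↦ 1) with hV
  have hV0 : 0 ≤ V := energy_nonneg
  have key : ∀ z ∈ S, ∀ w ∈ S, ‖w - z‖ ≤ ρ → minEnergy Ω p w ≤ minEnergy Ω p z →
      ∫ x in Ω, convexityDefect p (minimizer Ω p z x) (minimizer Ω p w x) ≤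
        p * (M / r / 2) * V * ‖w - z‖ := fun z hz w hw hwz hA ↦ by
    have h1 := integral_convexityDefect_le hΩ hp (memBergman_minimizer hΩ hbdd hp (hSΩ hz))
      (memBergman_minimizer hΩ hbdd hp (hSΩ hw)) z
    rw [energy_minimizer hΩ hbdd hp (hSΩ hz), energy_minimizer hΩ hbdd hp (hSΩ hw),
      minimizer_self hΩ hbdd hp (hSΩ hz)] at h1
    have h2 := hlip w hw z (by rw [norm_sub_rev]; linarith)
    rw [norm_sub_rev z w] at h2
    set t := M / r * ‖w - z‖ with ht
    have ht0 : 0 ≤ t := by positivity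
    have ht1 : t ≤ 1 / 2 :=
      (mul_le_mul_of_nonneg_left hwz (by positivity)).trans hMρ.le
    have h3 : 1 - t / 2 ≤ ‖(1 + minimizer Ω p w z) / 2‖ := by
      have h4 : (1 : ℂ) = (1 + minimizer Ω p w z) / 2 - (minimizer Ω p w z - 1) / 2 := by ring
      have h5 := norm_sub_le ((1 + minimizer Ω p w z) / 2) ((minimizer Ω p w z - 1) / 2)
      rw [← h4, norm_one, norm_div (minimizer Ω p w z - 1), Complex.norm_ofNat] at h5
      linarith
    have h6 : 1 - p * (t / 2) ≤ ‖(1 + minimizer Ω p w z) / 2‖ ^ p := by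
      have h7 := one_add_mul_self_le_rpow_one_add (s := -(t / 2)) (by linarith) hp.le
      calc 1 - p * (t / 2) = 1 + p * -(t / 2) := by ring
        _ ≤ (1 + -(t / 2)) ^ p := h7
        _ ≤ _ := Real.rpow_le_rpow (by linarith) (by linarith) (by linarith)
    have h8 := mul_le_mul_of_nonneg_right h6 (minEnergy_nonneg (Ω := Ω) (p := p) (z := z))
    have h9 : p * (t / 2) * minEnergy Ω p z ≤ p * (t / 2) * V := by
      have : minEnergy Ω p z ≤ V := minEnergy_le_energy_one hbdd hp
      gcongr
    calc _ ≤ p * (t / 2) * V := by linarith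
      _ = _ := by rw [ht]; ring
  have key' : ∀ z ∈ S, ∀ w ∈ S, ‖w - z‖ ≤ ρ →
      ∫ x in Ω, convexityDefect p (minimizer Ω p z x) (minimizer Ω p w x) ≤
        p * (M / r / 2) * V * ‖w - z‖ := fun z hz w hw hwz ↦ by
    rcases le_total (minEnergy Ω p w) (minEnergy Ω p z) with h | h
    · exact key z hz w hw hwz h
    · have := key w hw z hz (by rwa [norm_sub_rev]) h
      rw [norm_sub_rev z w] at this
      simpa only [convexityDefect_comm] using this
  obtain ⟨c, hc, hdef⟩ := exists_sq_le_convexityDefect hp hM0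
  have hR : 0 < ρ / 4 := by positivity
  set v := volume.real (ball (0 : EuclideanSpace ℂ (Fin n)) (ρ / 4)) with hv
  have hv0 : 0 ≤ v := ENNReal.toReal_nonneg
  set B := v⁻¹ * (c⁻¹ * (p * (M / r / 2) * V)) with hB
  have hp0 : 0 ≤ p := by linarith
  have hB0 : 0 ≤ B := by positivity
  refine ⟨ρ / 2, by positivity, √B / (ρ / 4) + M / r ^ 2, by positivity,
    fun z hz w hw hwz ↦ ?_⟩
  have hclose : ∀ x ∈ closedBall w (ρ / 4),
      ‖minimizer Ω p w x - minimizer Ω p z x‖ ≤ √B * √‖w - z‖ := fun x hx ↦ by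
    have hball : ∀ y ∈ ball x (ρ / 4), ‖y - z‖ ≤ ρ := fun y hy ↦ by
      rw [mem_ball] at hy
      rw [mem_closedBall] at hx
      rw [← dist_eq_norm] at hwz ⊢
      linarith [dist_triangle4 y x w z]
    have hball' : ∀ y ∈ ball x (ρ / 4), y ∈ closedBall z (3 * r) := fun y hy ↦ by
      rw [mem_closedBall_iff_norm]
      linarith [hball y hy]
    have h1 := norm_sub_rpow_le_integral_convexityDefect hΩ hp
      (memBergman_minimizer hΩ hbdd hp (hSΩ hz)) (memBergman_minimizer hΩ hbdd hp (hSΩ hw))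
      (s := 2) hR (by norm_num) hc (fun y hy ↦ (hb z hz).1 (hball' y hy)) fun y hy ↦ by
        refine hdef _ _ ?_ ((hb z hz).2 z (hSΩ hz) y (hball' y hy))
          ((hb z hz).2 w (hSΩ hw) y (hball' y hy))
        have h2 : ‖minimizer Ω p z y - 1‖ ≤ 1 / 2 := by
          rw [← hMρ]
          refine (hlip z hz y ((hball y hy).trans hρr)).trans ?_
          gcongr
          exact hball y hy
        have h3 := norm_sub_norm_le (1 : ℂ) (minimizer Ω p z y)
        rw [norm_sub_rev, norm_one] at h3
        linarith
    rw [Real.rpow_two, norm_sub_rev] at h1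
    rw [← Real.sqrt_mul hB0]
    refine Real.le_sqrt_of_sq_le (h1.trans ?_)
    calc _ ≤ v⁻¹ * (c⁻¹ * (p * (M / r / 2) * V * ‖w - z‖)) := by
          gcongr
          exact key' z hz w hw (by linarith)
      _ = B * ‖w - z‖ := by rw [hB]; ring
  have hsub : closedBall w (ρ / 4) ⊆ closedBall z (3 * r) := closedBall_subset_closedBall' (by
    rw [dist_eq_norm]; linarith)
  have hw' : w ∈ closedBall z (3 * r) := hsub (mem_closedBall_self hR.le)
  have h1 := norm_fderiv_le_of_closedBall hR
    (fun x hx ↦ (hd z hz w (hSΩ hw) x (hsub hx)).fun_sub (hd z hz z (hSΩ hz) x (hsub hx))) hclose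
  rw [fderiv_fun_sub (hd z hz w (hSΩ hw) w hw') (hd z hz z (hSΩ hz) w hw')] at h1
  have h2 := norm_fderiv_sub_fderiv_le hr (hd z hz z (hSΩ hz)) ((hb z hz).2 z (hSΩ hz))
    (w := w) (by linarith)
  have h3 : ‖w - z‖ ≤ √‖w - z‖ := Real.le_sqrt_of_sq_le (by
    rw [sq]
    exact mul_le_of_le_one_left (norm_nonneg _) (by linarith))
  calc _ ≤ ‖fderiv ℂ (minimizer Ω p w) w - fderiv ℂ (minimizer Ω p z) w‖ +
        ‖fderiv ℂ (minimizer Ω p z) w - fderiv ℂ (minimizer Ω p z) z‖ :=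
        norm_sub_le_norm_sub_add_norm_sub _ _ _
    _ ≤ √B * √‖w - z‖ / (ρ / 4) + M / r ^ 2 * √‖w - z‖ := by
        refine add_le_add h1 (h2.trans ?_)
        gcongr
    _ = _ := by ring

/-- Bounds near a compact set, uniform in the base point: for `dm_p(·, z)|_z`, for `K_p`, and for the
remainders of the Taylor expansions of order zero and one of `m_p(·, z)` at `z`. -/
theorem exists_norm_minimizer_sub_le (hΩ : IsOpen Ω) (hbdd : Bornology.IsBounded Ω)
    (hp : 1 < p) (hS : IsCompact S) (hSΩ : S ⊆ Ω) :
    ∃ δ > 0, δ ≤ 1 ∧ ∃ C ≥ (0 : ℝ), ∀ z ∈ S, ‖fderiv ℂ (minimizer Ω p z) z‖ ≤ C ∧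
      kernel Ω p z ≤ C ∧ ∀ w, ‖w - z‖ ≤ δ → ‖minimizer Ω p z w - 1‖ ≤ min 1 (C * ‖w - z‖) ∧
        ‖minimizer Ω p z w - 1 - fderiv ℂ (minimizer Ω p z) z (w - z)‖ ≤ C * ‖w - z‖ ^ 2 := by
  obtain ⟨r, hr, hr1, M, hM, hb⟩ := exists_norm_minimizer_le hΩ hbdd hp hS hSΩ
  have hM0 : 0 < M := by linarith
  set v := volume.real (ball (0 : EuclideanSpace ℂ (Fin n)) r) with hv
  have hv0 : 0 < v := ENNReal.toReal_pos (measure_ball_pos _ _ hr).ne' measure_ball_lt_top.ne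
  have hρr : r / M ≤ r := div_le_self hr.le hM
  have hle1 : M / r ≤ M / r + M / r ^ 2 + v⁻¹ := by
    have : 0 < M / r ^ 2 + v⁻¹ := by positivity
    linarith
  have hle2 : M / r ^ 2 ≤ M / r + M / r ^ 2 + v⁻¹ := by
    have : 0 < M / r + v⁻¹ := by positivity
    linarith
  have hle3 : v⁻¹ ≤ M / r + M / r ^ 2 + v⁻¹ := by
    have : 0 < M / r + M / r ^ 2 := by positivity
    linarith
  refine ⟨r / M, by positivity, hρr.trans hr1, M / r + M / r ^ 2 + v⁻¹, by positivity,
    fun z hz ↦ ?_⟩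
  have hd : ∀ x ∈ closedBall z (3 * r), DifferentiableAt ℂ (minimizer Ω p z) x := fun x hx ↦
    differentiableAt_minimizer hΩ hbdd hp (hSΩ hz) ((hb z hz).1 hx)
  have hbz := (hb z hz).2 z (hSΩ hz)
  have h13 : closedBall z r ⊆ closedBall z (3 * r) := closedBall_subset_closedBall (by linarith)
  have h23 : closedBall z (2 * r) ⊆ closedBall z (3 * r) :=
    closedBall_subset_closedBall (by linarith)
  refine ⟨?_, ?_, fun w hw ↦ ⟨?_, ?_⟩⟩
  · exact (norm_fderiv_le_of_closedBall hr (fun x hx ↦ hd x (h13 hx))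
      fun x hx ↦ hbz x (h13 hx)).trans hle1
  · rw [kernel_eq_inv_minEnergy]
    refine le_trans ?_ hle3
    gcongr
    exact volume_ball_le_minEnergy hΩ hbdd hp hr
      (ball_subset_closedBall.trans (h13.trans (hb z hz).1))
  · have h1 := norm_sub_le_of_closedBall hr (fun x hx ↦ hd x (h23 hx))
      (fun x hx ↦ hbz x (h23 hx)) (hw.trans hρr)
    rw [minimizer_self hΩ hbdd hp (hSΩ hz)] at h1
    refine le_min (h1.trans ?_) (h1.trans ?_)
    · calc M / r * ‖w - z‖ ≤ M / r * (r / M) := by gcongr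
        _ = 1 := by field_simp
    · gcongr
  · have h1 := norm_sub_sub_fderiv_le hr hd hbz (hw.trans hρr)
    rw [minimizer_self hΩ hbdd hp (hSΩ hz)] at h1
    refine h1.trans ?_
    gcongr

end LocalEstimates

/-! ### Differentiability of the kernel -/

section KernelDerivative

variable {n : ℕ} {Ω S : Set (EuclideanSpace ℂ (Fin n))} {p : ℝ}
  {z w : EuclideanSpace ℂ (Fin n)}

/-- The real linear form `p K_p(z) Re dm_p(·, z)|_z`, which is the differential of `K_p` at `z`. -/
def kernelDeriv (Ω : Set (EuclideanSpace ℂ (Fin n))) (p : ℝ) (z : EuclideanSpace ℂ (Fin n)) :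
    EuclideanSpace ℂ (Fin n) →L[ℝ] ℝ :=
  (p * kernel Ω p z) •
    (Complex.reCLM ∘L (fderiv ℂ (minimizer Ω p z) z).restrictScalars ℝ)

theorem kernelDeriv_apply (v : EuclideanSpace ℂ (Fin n)) :
    kernelDeriv Ω p z v = p * kernel Ω p z * (fderiv ℂ (minimizer Ω p z) z v).re := rfl

theorem kernel_nonneg : 0 ≤ kernel Ω p z := Real.rpow_nonneg minNorm_nonneg _

/-- The lower bound for `K_p(w)` given by the competitor `m_p(·, z)`, linearized by Bernoulli's
inequality. -/
theorem le_kernel_sub_kernel (hΩ : IsOpen Ω) (hbdd : Bornology.IsBounded Ω) (hp : 1 < p)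
    (hz : z ∈ Ω) (hw : w ∈ Ω) (h : ‖minimizer Ω p z w - 1‖ ≤ 1) :
    p * kernel Ω p z * (minimizer Ω p z w - 1).re ≤ kernel Ω p w - kernel Ω p z := by
  have hz0 := minEnergy_pos hΩ hbdd hp hz
  have hw0 := minEnergy_pos hΩ hbdd hp hw
  have h1 := norm_rpow_mul_minEnergy_le (z := w) hp (memBergman_minimizer hΩ hbdd hp hz)
  rw [energy_minimizer hΩ hbdd hp hz] at h1
  have h2 : ‖minimizer Ω p z w‖ ^ p * kernel Ω p z ≤ kernel Ω p w := by
    rw [kernel_eq_inv_minEnergy, kernel_eq_inv_minEnergy, ← div_eq_mul_inv, inv_eq_one_div,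
      div_le_div_iff₀ hz0 hw0, one_mul]
    exact h1
  have h3 : -1 ≤ (minimizer Ω p z w - 1).re := by
    have := (abs_le.1 (Complex.abs_re_le_norm (minimizer Ω p z w - 1))).1
    linarith
  have h4 : 1 + p * (minimizer Ω p z w - 1).re ≤ ‖minimizer Ω p z w‖ ^ p := by
    refine (one_add_mul_self_le_rpow_one_add h3 hp.le).trans
      (Real.rpow_le_rpow (by linarith) ?_ (by linarith))
    have := Complex.re_le_norm (minimizer Ω p z w)
    simpa using this
  have h5 := mul_le_mul_of_nonneg_right h4 (kernel_nonneg (Ω := Ω) (p := p) (z := z))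
  linarith

/-- The first order expansion of the kernel. The competitor `m_p(·, z)` at `w` bounds the increment
`K_p(w) - K_p(z)` from below by its linear part at `z`, and the competitor `m_p(·, w)` at `z` bounds
it from above by its linear part at `w`. The two linear parts differ by the Hölder estimate for the
minimizers. -/
theorem exists_kernel_expansion (hΩ : IsOpen Ω) (hbdd : Bornology.IsBounded Ω)
    (hp : 1 < p) (hS : IsCompact S) (hSΩ : S ⊆ Ω) :
    ∃ δ > 0, ∃ C ≥ (0 : ℝ), ∀ z ∈ S, ‖kernelDeriv Ω p z‖ ≤ C ∧ ∀ w ∈ S, ‖w - z‖ ≤ δ →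
      ‖kernelDeriv Ω p w - kernelDeriv Ω p z‖ ≤ C * √‖w - z‖ ∧
      |kernel Ω p w - kernel Ω p z - kernelDeriv Ω p z (w - z)| ≤ C * √‖w - z‖ * ‖w - z‖ := by
  obtain ⟨δ₁, hδ₁, C₁, hC₁, h₁⟩ := exists_norm_fderiv_minimizer_sub_le hΩ hbdd hp hS hSΩ
  obtain ⟨δ₂, hδ₂, hδ₂1, C₂, hC₂, h₂⟩ := exists_norm_minimizer_sub_le hΩ hbdd hp hS hSΩ
  have hp0 : 0 ≤ p := by linarith
  have hre : ∀ L : EuclideanSpace ℂ (Fin n) →L[ℂ] ℂ,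
      ‖Complex.reCLM ∘L L.restrictScalars ℝ‖ ≤ ‖L‖ := fun L ↦
    ContinuousLinearMap.opNorm_le_bound _ (norm_nonneg _) fun v ↦
      (Complex.abs_re_le_norm _).trans (L.le_opNorm v)
  -- one half of the Lipschitz bound for the kernel
  have hlip : ∀ z ∈ S, ∀ w ∈ S, ‖w - z‖ ≤ δ₂ →
      -(p * C₂ * C₂ * ‖w - z‖) ≤ kernel Ω p w - kernel Ω p z := fun z hz w hw hwz ↦ by
    have h3 := ((h₂ z hz).2.2 w hwz).1
    refine le_trans ?_ (le_kernel_sub_kernel hΩ hbdd hp (hSΩ hz) (hSΩ hw)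
      (h3.trans (min_le_left _ _)))
    have h4 := (abs_le.1 ((Complex.abs_re_le_norm (minimizer Ω p z w - 1)).trans
      (h3.trans (min_le_right _ _)))).1
    have h5 : p * kernel Ω p z * (C₂ * ‖w - z‖) ≤ p * C₂ * (C₂ * ‖w - z‖) := by
      gcongr
      exact (h₂ z hz).2.1
    have h6 := mul_le_mul_of_nonneg_left h4
      (mul_nonneg hp0 (kernel_nonneg (Ω := Ω) (p := p) (z := z)))
    linarith
  -- the lower bound in the expansion
  have hexp : ∀ z ∈ S, ∀ w ∈ S, ‖w - z‖ ≤ δ₂ →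
      kernelDeriv Ω p z (w - z) - p * C₂ * C₂ * ‖w - z‖ ^ 2 ≤ kernel Ω p w - kernel Ω p z :=
    fun z hz w hw hwz ↦ by
    obtain ⟨h3, h4⟩ := (h₂ z hz).2.2 w hwz
    refine le_trans ?_ (le_kernel_sub_kernel hΩ hbdd hp (hSΩ hz) (hSΩ hw)
      (h3.trans (min_le_left _ _)))
    have h5 := (abs_le.1 ((Complex.abs_re_le_norm _).trans h4)).1
    rw [Complex.sub_re] at h5
    have h6 : p * kernel Ω p z * (C₂ * ‖w - z‖ ^ 2) ≤ p * C₂ * (C₂ * ‖w - z‖ ^ 2) := by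
      gcongr
      exact (h₂ z hz).2.1
    have h7 := mul_le_mul_of_nonneg_left h5
      (mul_nonneg hp0 (kernel_nonneg (Ω := Ω) (p := p) (z := z)))
    rw [kernelDeriv_apply]
    linarith
  set B := p * C₂ * C₁ + p * (p * C₂ * C₂) * C₂ with hB
  have hB0 : 0 ≤ B := by positivity
  have hsqrt : ∀ z w : EuclideanSpace ℂ (Fin n), ‖w - z‖ ≤ δ₂ → ‖w - z‖ ≤ √‖w - z‖ :=
    fun z w h ↦ Real.le_sqrt_of_sq_le (by
      rw [sq]
      exact mul_le_of_le_one_left (norm_nonneg _) (by linarith))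
  have hderiv : ∀ z ∈ S, ∀ w ∈ S, ‖w - z‖ ≤ δ₁ → ‖w - z‖ ≤ δ₂ →
      ‖kernelDeriv Ω p w - kernelDeriv Ω p z‖ ≤ B * √‖w - z‖ := fun z hz w hw hwz1 hwz2 ↦ by
    have hK : |kernel Ω p w - kernel Ω p z| ≤ p * C₂ * C₂ * √‖w - z‖ := by
      have h3 := hlip z hz w hw hwz2
      have h4 := hlip w hw z hz (by rwa [norm_sub_rev])
      rw [norm_sub_rev z w] at h4
      refine le_trans (abs_le.2 ⟨h3, by linarith⟩) ?_
      gcongr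
      exact hsqrt z w hwz2
    set L : EuclideanSpace ℂ (Fin n) → (EuclideanSpace ℂ (Fin n) →L[ℂ] ℂ) :=
      fun x ↦ fderiv ℂ (minimizer Ω p x) x with hL
    have hsplit : kernelDeriv Ω p w - kernelDeriv Ω p z =
        (p * kernel Ω p w) • (Complex.reCLM ∘L (L w - L z).restrictScalars ℝ) +
        (p * (kernel Ω p w - kernel Ω p z)) • (Complex.reCLM ∘L (L z).restrictScalars ℝ) := by
      ext v
      simp only [sub_apply, add_apply,
        smul_apply, ContinuousLinearMap.comp_apply, kernelDeriv_apply,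
        ContinuousLinearMap.coe_restrictScalars', Complex.reCLM_apply, Complex.sub_re, smul_eq_mul,
        hL]
      ring
    rw [hsplit]
    refine (norm_add_le _ _).trans ?_
    rw [norm_smul, norm_smul, norm_mul, norm_mul, Real.norm_of_nonneg hp0,
      Real.norm_of_nonneg kernel_nonneg, Real.norm_eq_abs]
    calc _ ≤ p * C₂ * (C₁ * √‖w - z‖) + p * (p * C₂ * C₂ * √‖w - z‖) * C₂ := by
          gcongr
          · exact (h₂ w hw).2.1
          · exact (hre _).trans (h₁ z hz w hw hwz1)
          · exact (hre _).trans (h₂ z hz).1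
      _ = B * √‖w - z‖ := by rw [hB]; ring
  refine ⟨min δ₁ δ₂, by positivity, B + p * C₂ * C₂, by positivity, fun z hz ↦
    ⟨?_, fun w hw hwz ↦ ?_⟩⟩
  · rw [kernelDeriv, norm_smul, norm_mul, Real.norm_of_nonneg hp0,
      Real.norm_of_nonneg kernel_nonneg]
    calc _ ≤ p * C₂ * C₂ := by
          gcongr
          · exact (h₂ z hz).2.1
          · exact (hre _).trans (h₂ z hz).1
      _ ≤ _ := by linarith
  · have hwz1 := hwz.trans (min_le_left _ _)
    have hwz2 := hwz.trans (min_le_right _ _)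
    have hD := hderiv z hz w hw hwz1 hwz2
    have hsq : ‖w - z‖ ^ 2 ≤ √‖w - z‖ * ‖w - z‖ := by
      rw [sq]
      gcongr
      exact hsqrt z w hwz2
    have h3 := hexp z hz w hw hwz2
    have h4 := hexp w hw z hz (by rwa [norm_sub_rev])
    have h5 : (kernelDeriv Ω p w - kernelDeriv Ω p z) (w - z) ≤ B * √‖w - z‖ * ‖w - z‖ :=
      ((le_abs_self _).trans ((kernelDeriv Ω p w - kernelDeriv Ω p z).le_opNorm (w - z))).trans
        (by gcongr)
    have h6 : kernelDeriv Ω p w (z - w) = -kernelDeriv Ω p w (w - z) := by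
      rw [← map_neg, neg_sub]
    rw [sub_apply] at h5
    rw [norm_sub_rev z w, h6] at h4
    have h7 : p * C₂ * C₂ * ‖w - z‖ ^ 2 ≤ p * C₂ * C₂ * (√‖w - z‖ * ‖w - z‖) := by gcongr
    have h8 : 0 ≤ B * √‖w - z‖ * ‖w - z‖ := by positivity
    refine ⟨hD.trans ?_, abs_le.2 ⟨?_, ?_⟩⟩
    · gcongr
      have : 0 ≤ p * C₂ * C₂ := by positivity
      linarith
    · linarith
    · linarith

theorem hasFDerivAt_kernel (hΩ : IsOpen Ω) (hbdd : Bornology.IsBounded Ω) (hp : 1 < p)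
    (hz : z ∈ Ω) : HasFDerivAt (kernel Ω p) (kernelDeriv Ω p z) z := by
  obtain ⟨r, hr, hsub⟩ := Metric.nhds_basis_closedBall.mem_iff.1 (hΩ.mem_nhds hz)
  obtain ⟨δ, hδ, C, hC, h⟩ := exists_kernel_expansion hΩ hbdd hp (isCompact_closedBall z r) hsub
  have hzS : z ∈ closedBall z r := mem_closedBall_self hr.le
  rw [hasFDerivAt_iff_isLittleO]
  have hO : (fun w ↦ kernel Ω p w - kernel Ω p z - kernelDeriv Ω p z (w - z)) =O[𝓝 z]
      fun w ↦ √‖w - z‖ * ‖w - z‖ := by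
    refine Asymptotics.IsBigO.of_bound C ?_
    filter_upwards [closedBall_mem_nhds z hr, closedBall_mem_nhds z hδ] with w hw hw'
    rw [mem_closedBall_iff_norm] at hw'
    have := ((h z hzS).2 w hw hw').2
    rw [Real.norm_eq_abs, Real.norm_of_nonneg (by positivity)]
    linarith
  refine hO.trans_isLittleO ?_
  have ho : (fun w : EuclideanSpace ℂ (Fin n) ↦ √‖w - z‖) =o[𝓝 z] fun _ ↦ (1 : ℝ) := by
    rw [Asymptotics.isLittleO_one_iff]
    have : Continuous fun w : EuclideanSpace ℂ (Fin n) ↦ √‖w - z‖ := by fun_prop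
    simpa using this.tendsto z
  have := ho.mul_isBigO (Asymptotics.isBigO_refl (fun w ↦ ‖w - z‖) (𝓝 z))
  simp only [one_mul] at this
  exact Asymptotics.isLittleO_norm_right.1 this

/-- The Hölder estimate of `exists_kernel_expansion` at small distances, combined with the
boundedness of the differential at large ones. -/
theorem exists_holderOnWith_kernelDeriv (hΩ : IsOpen Ω) (hbdd : Bornology.IsBounded Ω) (hp : 1 < p)
    (hS : IsCompact S) (hSΩ : S ⊆ Ω) :
    ∃ C : ℝ≥0, HolderOnWith C (1 / 2) (kernelDeriv Ω p) S := by
  obtain ⟨δ, hδ, C, hC, h⟩ := exists_kernel_expansion hΩ hbdd hp hS hSΩ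
  refine ⟨(C + 2 * C / √δ).toNNReal, fun z hz w hw ↦ ?_⟩
  have hreal : dist (kernelDeriv Ω p z) (kernelDeriv Ω p w) ≤
      (C + 2 * C / √δ) * dist z w ^ (1 / 2 : ℝ) := by
    rw [← Real.sqrt_eq_rpow, dist_comm, dist_comm z w, dist_eq_norm, dist_eq_norm]
    rcases le_total ‖w - z‖ δ with hle | hle
    · refine (((h z hz).2 w hw hle).1).trans ?_
      gcongr
      have : 0 ≤ 2 * C / √δ := by positivity
      linarith
    · calc ‖kernelDeriv Ω p w - kernelDeriv Ω p z‖
          ≤ ‖kernelDeriv Ω p w‖ + ‖kernelDeriv Ω p z‖ := norm_sub_le _ _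
        _ ≤ 2 * C / √δ * √δ := by
            rw [div_mul_cancel₀ _ (Real.sqrt_pos.2 hδ).ne']
            linarith [(h w hw).1, (h z hz).1]
        _ ≤ (C + 2 * C / √δ) * √‖w - z‖ := by
            gcongr
            linarith
  rw [edist_dist, edist_dist, ENNReal.ofReal_rpow_of_nonneg dist_nonneg (by positivity)]
  change _ ≤ ENNReal.ofReal _ * _
  rw [← ENNReal.ofReal_mul (by positivity)]
  refine ENNReal.ofReal_le_ofReal ?_
  simpa using hreal

theorem isC1Holder_kernel (hΩ : IsOpen Ω) (hbdd : Bornology.IsBounded Ω) (hp : 1 < p) :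
    IsC1Holder (1 / 2) Ω (kernel Ω p) := by
  have hfderiv : EqOn (fderiv ℝ (kernel Ω p)) (kernelDeriv Ω p) Ω :=
    fun z hz ↦ (hasFDerivAt_kernel hΩ hbdd hp hz).fderiv
  have hholder : ∀ S : Set (EuclideanSpace ℂ (Fin n)), IsCompact S → S ⊆ Ω →
      ∃ C : ℝ≥0, HolderOnWith C (1 / 2) (fderiv ℝ (kernel Ω p)) S := fun S hS hSΩ ↦ by
    obtain ⟨C, hC⟩ := exists_holderOnWith_kernelDeriv hΩ hbdd hp hS hSΩ
    refine ⟨C, fun z hz w hw ↦ ?_⟩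
    rw [hfderiv (hSΩ hz), hfderiv (hSΩ hw)]
    exact hC z hz w hw
  refine ⟨?_, hholder⟩
  rw [show (1 : WithTop ℕ∞) = 0 + 1 by norm_num, contDiffOn_succ_iff_fderiv_of_isOpen hΩ]
  refine ⟨fun z hz ↦ (hasFDerivAt_kernel hΩ hbdd hp hz).differentiableAt.differentiableWithinAt,
    by simp, contDiffOn_zero.2 fun z hz ↦ ?_⟩
  obtain ⟨r, hr, hsub⟩ := Metric.nhds_basis_closedBall.mem_iff.1 (hΩ.mem_nhds hz)
  obtain ⟨C, hC⟩ := hholder _ (isCompact_closedBall z r) hsub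
  exact ((hC.uniformContinuousOn (by norm_num)).continuousOn.continuousAt
    (closedBall_mem_nhds z hr)).continuousWithinAt

theorem realPartial_kernel (hΩ : IsOpen Ω) (hbdd : Bornology.IsBounded Ω) (hp : 1 < p)
    (j : Fin n ⊕ Fin n) (hz : z ∈ Ω) :
    realPartial (kernel Ω p) j z =
      p * (realPartial (fun w ↦ offDiagKernel Ω p w z) j z).re := by
  have h1 := (hasFDerivAt_kernel hΩ hbdd hp hz).hasLineDerivAt (realBasis j)
  have h2 : HasFDerivAt (fun w ↦ offDiagKernel Ω p w z) _ z :=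
    ((differentiableAt_minimizer hΩ hbdd hp hz hz).hasFDerivAt.mul_const
      (kernel Ω p z : ℂ)).restrictScalars ℝ
  rw [realPartial, realPartial, h1.lineDeriv, (h2.hasLineDerivAt (realBasis j)).lineDeriv,
    kernelDeriv_apply]
  simp
  ring

end KernelDerivative

end PBergman

end

theorem theorem1p1 {n : ℕ} (Ω : Set (EuclideanSpace ℂ (Fin n)))
    (hΩ_open : IsOpen Ω) (hΩ_conn : IsConnected Ω) (hΩ_bdd : Bornology.IsBounded Ω)
    (p : ℝ) (hp : 1 < p) :
    -- the minimizer `m_p(·, z)`, through which `K_p(·, z)` is defined, exists and is unique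
    (∀ z ∈ Ω, (∃ f, PBergman.IsMinimizer Ω p z f) ∧
      ∀ f g, PBergman.IsMinimizer Ω p z f → PBergman.IsMinimizer Ω p z g → EqOn f g Ω) ∧
    PBergman.IsC1Holder (1 / 2) Ω (PBergman.kernel Ω p) ∧
    ∀ (j : Fin n ⊕ Fin n), ∀ z ∈ Ω,
      PBergman.realPartial (PBergman.kernel Ω p) j z =
        p * (PBergman.realPartial (fun w => PBergman.offDiagKernel Ω p w z) j z).re :=
  ⟨fun _ hz ↦ ⟨PBergman.exists_isMinimizer hΩ_open hΩ_bdd hp hz,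
      fun _ _ hf hg ↦ hf.eqOn hΩ_open hp hg⟩,
    PBergman.isC1Holder_kernel hΩ_open hΩ_bdd hp,
    fun j _ hz ↦ PBergman.realPartial_kernel hΩ_open hΩ_bdd hp j hz⟩
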